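/- Let $\mathbb T$ be the unit circle, $m_n$ and $m$ the products of the normalized Lebesgue measure on $\mathbb T^n$ and $\mathbb T^\infty=\mathbb T^{\mathbb N}$, and let $\mathbb Z^{(\mathbb N)}$, $\mathbb N_0^{(\mathbb N)}$ be the sets of finitely supported sequences in $\mathbb Z$ and in $\mathbb N_0$. For $1\le p<\infty$ let $H_p(\mathbb T^\infty)$ be the subspace of those $f\in L_p(\mathbb T^\infty)$ whose Fourier coefficients $\hat f(\alpha)=\int_{\mathbb T^\infty} f(w)\,w^{-\alpha}\,dm(w)$ vanish for all $\alpha\in\mathbb Z^{(\mathbb N)}\setminus\mathbb N_0^{(\mathbb N)}$, with the norm of $L_p(\mathbb T^\infty)$. Let $\mathbb D^\infty\cap\ell_2=\{z\in\ell_2: \sup_i|z_i|<1\}$, an open subset of the complex Hilbert space $\ell_2$, and let $H_p(\mathbb D^\infty)$ be the space of all holomorphic (that is, complex Fréchet differentiable) functions $g:\mathbb D^\infty\cap\ell_2\to\mathbb C$ with $$\|g\|_{H_p(\mathbb D^\infty)}=\sup_{n\in\mathbb N}\ \sup_{0<r<1}\Big(\int_{\mathbb T^n}|g(rw_1,\dots,rw_n,0,0,\dots)|^p\,dm_n(w_1,\dots,w_n)\Big)^{1/p}<\infty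 .$$ **Theorem 5.1.** Let $1\le p<\infty$. For every $f\in H_p(\mathbb T^\infty)$ and $z\in\mathbb D^\infty\cap\ell_2$ the series $$\phi(f)(z)=\sum_{\alpha\in\mathbb N_0^{(\mathbb N)}}\hat f(\alpha)\,z^\alpha$$ converges absolutely, $\phi(f)$ belongs to $H_p(\mathbb D^\infty)$, and $\phi:H_p(\mathbb T^\infty)\to H_p(\mathbb D^\infty)$ is a linear isometry. If $1<p<\infty$, then $\phi$ is onto. If $p=1$, then $\phi(H_1(\mathbb T^\infty))$ is the closure in $H_1(\mathbb D^\infty)$, for the norm $\|\cdot\|_{H_1(\mathbb D^\infty)}$, of the linear span of the monomials $z^\alpha$, $\alpha\in\mathbb N_0^{(\mathbb N)}$. -/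

import Mathlib

open MeasureTheory
open scoped ENNReal

noncomputable section

namespace HardyInf

/-- The Borel `σ`-algebra on the unit circle `𝕋`. -/
instance instMeasurableSpaceCircle : MeasurableSpace Circle := borel Circle

instance instBorelSpaceCircle : BorelSpace Circle := ⟨rfl⟩

/-- The normalized Haar (Lebesgue) measure on the unit circle `𝕋`. -/
def circleMeasure : Measure Circle := Measure.haarMeasure ⊤

instance instIsProbabilityMeasureCircle : IsProbabilityMeasure circleMeasure :=
  ⟨Measure.haarMeasure_self⟩

/-- The product measure `m_n` on the polytorus `𝕋ⁿ`. -/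
abbrev torusMeasureFin (n : ℕ) : Measure (Fin n → Circle) :=
  Measure.pi fun _ => circleMeasure

/-- The product measure `m` on the infinite dimensional polytorus `𝕋^∞`. -/
abbrev torusMeasure : Measure (ℕ → Circle) :=
  Measure.infinitePi fun _ => circleMeasure

/-- The character `w ↦ w^α = ∏ w_i^{α_i}` of `𝕋^∞`, for a finitely supported integer
multi-index `α`. -/
def torusMonomial (α : ℕ →₀ ℤ) (w : ℕ → Circle) : Circle :=
  α.prod fun i k => w i ^ k

/-- The Fourier coefficient `∫ f(w) w^{-α} dm(w)`. -/
def fourierCoeff (f : (ℕ → Circle) → ℂ) (α : ℕ →₀ ℤ) : ℂ :=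
  ∫ w, f w * (torusMonomial (-α) w : ℂ) ∂torusMeasure

/-- A natural multi-index regarded as an integer multi-index. -/
def natIndex (α : ℕ →₀ ℕ) : ℕ →₀ ℤ :=
  α.mapRange (fun k : ℕ => (k : ℤ)) Nat.cast_zero

theorem continuous_torusMonomial (α : ℕ →₀ ℤ) :
    Continuous fun w : ℕ → Circle => (torusMonomial α w : ℂ) := by
  have h : Continuous fun w : ℕ → Circle => ∏ i ∈ α.support, w i ^ α i := by fun_prop
  exact continuous_subtype_val.comp h

theorem integrable_mul_torusMonomial {p : ℝ≥0∞} [Fact (1 ≤ p)] (f : Lp ℂ p torusMeasure)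
    (α : ℕ →₀ ℤ) :
    Integrable (fun w => f w * (torusMonomial α w : ℂ)) torusMeasure := by
  have hf : Integrable f torusMeasure := (Lp.memLp f).integrable Fact.out
  refine hf.mul_bdd (c := 1) ?_ ?_
  · exact (continuous_torusMonomial α).aestronglyMeasurable
  · exact Filter.Eventually.of_forall fun w => (Circle.norm_coe _).le

/-- The Hardy space `H_p(𝕋^∞)`: the functions in `L_p(𝕋^∞)` all of whose Fourier coefficients
with an index outside `ℕ₀^(ℕ)` vanish.  It carries the norm of `L_p(𝕋^∞)`. -/
def HpTorus (p : ℝ≥0∞) [Fact (1 ≤ p)] : Submodule ℂ (Lp ℂ p torusMeasure) where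
  carrier := {f | ∀ α : ℕ →₀ ℤ, (∃ i, α i < 0) → fourierCoeff f α = 0}
  zero_mem' := fun α _ => by
    have h : (fun w => (0 : Lp ℂ p torusMeasure) w * (torusMonomial (-α) w : ℂ))
        =ᵐ[torusMeasure] fun _ => 0 := by
      filter_upwards [Lp.coeFn_zero ℂ p torusMeasure] with w hw
      rw [hw, Pi.zero_apply, zero_mul]
    rw [fourierCoeff, integral_congr_ae h, integral_zero]
  add_mem' := fun {f g} hf hg α hα => by
    have h : (fun w => (f + g : Lp ℂ p torusMeasure) w * (torusMonomial (-α) w : ℂ))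
        =ᵐ[torusMeasure] fun w => f w * (torusMonomial (-α) w : ℂ)
          + g w * (torusMonomial (-α) w : ℂ) := by
      filter_upwards [Lp.coeFn_add f g] with w hw
      rw [hw, Pi.add_apply, add_mul]
    have h1 := hf α hα
    have h2 := hg α hα
    rw [fourierCoeff] at h1 h2 ⊢
    rw [integral_congr_ae h, integral_add (integrable_mul_torusMonomial f _)
      (integrable_mul_torusMonomial g _), h1, h2, add_zero]
  smul_mem' := fun c f hf α hα => by
    have h : (fun w => (c • f : Lp ℂ p torusMeasure) w * (torusMonomial (-α) w : ℂ))
        =ᵐ[torusMeasure] fun w => c * (f w * (torusMonomial (-α) w : ℂ)) := by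
      filter_upwards [Lp.coeFn_smul c f] with w hw
      rw [hw, Pi.smul_apply, smul_eq_mul, mul_assoc]
    have h1 := hf α hα
    rw [fourierCoeff] at h1 ⊢
    rw [integral_congr_ae h, integral_const_mul, h1, mul_zero]

/-- The complex Hilbert space `ℓ₂`. -/
abbrev ellTwo : Type := lp (fun _ : ℕ => ℂ) 2

/-- The domain `𝔻^∞ ∩ ℓ₂`, as a subset of `ℓ₂`.  (An element of `ℓ₂` is a null sequence, so
`|z_i| < 1` for all `i` is the same as `sup_i |z_i| < 1`.) -/
def polydisc : Set ellTwo := {z | ∀ i, ‖z i‖ < 1}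

/-- A function on `𝔻^∞ ∩ ℓ₂` is holomorphic if it is complex Fréchet differentiable with
respect to the norm of `ℓ₂`. -/
def IsHolomorphic (g : polydisc → ℂ) : Prop :=
  ∃ G : ellTwo → ℂ, DifferentiableOn ℂ G polydisc ∧ ∀ z : polydisc, G z = g z

/-- The point `(a_1, …, a_n, 0, 0, …)` of `ℓ₂`. -/
def finPoint {n : ℕ} (a : Fin n → ℂ) : ellTwo :=
  ∑ i : Fin n, lp.single 2 (i : ℕ) (a i)

theorem finPoint_apply {n : ℕ} (a : Fin n → ℂ) (k : ℕ) :
    finPoint a k = if h : k < n then a ⟨k, h⟩ else 0 := by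
  unfold finPoint
  rw [lp.coeFn_sum, Finset.sum_apply]
  split_ifs with h
  · rw [Finset.sum_eq_single ⟨k, h⟩]
    · simp
    · intro b _ hb
      have : k ≠ (b : ℕ) := fun h' => hb (Fin.ext h'.symm)
      simp [this]
    · simp
  · refine Finset.sum_eq_zero fun b _ => ?_
    have : k ≠ (b : ℕ) := fun h' => h (h' ▸ b.2)
    simp [this]

theorem finPoint_mem {n : ℕ} {a : Fin n → ℂ} (ha : ∀ i, ‖a i‖ < 1) :
    finPoint a ∈ polydisc := by
  intro k
  rw [finPoint_apply]
  split_ifs with h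
  · exact ha _
  · simp

theorem norm_radius_mul_lt {n : ℕ} (r : Set.Ioo (0 : ℝ) 1) (w : Fin n → Circle) (i : Fin n) :
    ‖((r : ℝ) : ℂ) * (w i : ℂ)‖ < 1 := by
  rw [norm_mul, Circle.norm_coe, mul_one, Complex.norm_real, Real.norm_of_nonneg r.2.1.le]
  exact r.2.2

/-- The point `(r w_1, …, r w_n, 0, 0, …)` of `𝔻^∞ ∩ ℓ₂`. -/
def torusPoint {n : ℕ} (r : Set.Ioo (0 : ℝ) 1) (w : Fin n → Circle) : polydisc :=
  ⟨finPoint fun i => ((r : ℝ) : ℂ) * (w i : ℂ), finPoint_mem (norm_radius_mul_lt r w)⟩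

/-- The quantity `sup_n sup_{0<r<1} (∫_{𝕋ⁿ} |g(r w_1, …, r w_n, 0, …)|^p dm_n(w))^{1/p}`,
possibly infinite.  (For `n = 0` the integral is `|g(0)|^p`, which for holomorphic `g` does not
exceed the integrals for `n ≥ 1`.) -/
def hpNorm (p : ℝ≥0∞) (g : polydisc → ℂ) : ℝ≥0∞ :=
  ⨆ (n : ℕ) (r : Set.Ioo (0 : ℝ) 1),
    eLpNorm (fun w : Fin n → Circle => g (torusPoint r w)) p (torusMeasureFin n)

theorem eLpNorm_le_hpNorm (p : ℝ≥0∞) (g : polydisc → ℂ) (n : ℕ) (r : Set.Ioo (0 : ℝ) 1) :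
    eLpNorm (fun w : Fin n → Circle => g (torusPoint r w)) p (torusMeasureFin n) ≤ hpNorm p g :=
  le_iSup₂ (f := fun (n : ℕ) (r : Set.Ioo (0 : ℝ) 1) =>
    eLpNorm (fun w : Fin n → Circle => g (torusPoint r w)) p (torusMeasureFin n)) n r

theorem continuous_finPoint {n : ℕ} : Continuous fun a : Fin n → ℂ => finPoint a := by
  unfold finPoint
  refine continuous_finsetSum _ fun i _ => ?_
  exact (lp.isometry_single (E := fun _ : ℕ => ℂ) (p := 2) (i : ℕ)).continuous.comp
    (continuous_apply i)

theorem IsHolomorphic.continuous {g : polydisc → ℂ} (hg : IsHolomorphic g) : Continuous g := by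
  obtain ⟨G, hG, h⟩ := hg
  have : g = polydisc.domRestrict G := funext fun z => (h z).symm
  rw [this]
  exact hG.continuousOn.domRestrict

theorem continuous_torusPoint {n : ℕ} (r : Set.Ioo (0 : ℝ) 1) :
    Continuous fun w : Fin n → Circle => torusPoint r w := by
  refine Continuous.subtype_mk (continuous_finPoint.comp ?_) _
  fun_prop

theorem IsHolomorphic.aestronglyMeasurable {g : polydisc → ℂ} (hg : IsHolomorphic g) {n : ℕ}
    (r : Set.Ioo (0 : ℝ) 1) :
    AEStronglyMeasurable (fun w : Fin n → Circle => g (torusPoint r w)) (torusMeasureFin n) :=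
  (hg.continuous.comp (continuous_torusPoint r)).aestronglyMeasurable

theorem IsHolomorphic.zero : IsHolomorphic 0 := ⟨0, by fun_prop, fun _ => rfl⟩

theorem IsHolomorphic.add {g h : polydisc → ℂ} (hg : IsHolomorphic g) (hh : IsHolomorphic h) :
    IsHolomorphic (g + h) := by
  obtain ⟨G, hG, h1⟩ := hg
  obtain ⟨H, hH, h2⟩ := hh
  exact ⟨G + H, hG.add hH, fun z => by simp [h1, h2]⟩

theorem IsHolomorphic.smul {g : polydisc → ℂ} (c : ℂ) (hg : IsHolomorphic g) :
    IsHolomorphic (c • g) := by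
  obtain ⟨G, hG, h1⟩ := hg
  exact ⟨c • G, hG.const_smul c, fun z => by simp [h1]⟩

theorem hpNorm_zero (p : ℝ≥0∞) : hpNorm p 0 = 0 := by
  simp [hpNorm]

theorem hpNorm_add_le {p : ℝ≥0∞} [hp : Fact (1 ≤ p)] {g h : polydisc → ℂ}
    (hg : IsHolomorphic g) (hh : IsHolomorphic h) :
    hpNorm p (g + h) ≤ hpNorm p g + hpNorm p h := by
  refine iSup₂_le fun n r => ?_
  refine (eLpNorm_add_le (hg.aestronglyMeasurable r) (hh.aestronglyMeasurable r) hp.out).trans ?_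
  exact add_le_add (eLpNorm_le_hpNorm p g n r) (eLpNorm_le_hpNorm p h n r)

theorem hpNorm_smul (p : ℝ≥0∞) (c : ℂ) (g : polydisc → ℂ) :
    hpNorm p (c • g) = ‖c‖ₑ * hpNorm p g := by
  simp only [hpNorm, ENNReal.mul_iSup]
  refine iSup_congr fun n => iSup_congr fun r => ?_
  exact eLpNorm_const_smul c (fun w : Fin n → Circle => g (torusPoint r w)) p _

/-- The underlying vector space of `H_p(𝔻^∞)`: the holomorphic functions on `𝔻^∞ ∩ ℓ₂` with
finite `hpNorm`. -/
def hpSubmodule (p : ℝ≥0∞) [Fact (1 ≤ p)] : Submodule ℂ (polydisc → ℂ) where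
  carrier := {g | IsHolomorphic g ∧ hpNorm p g < ∞}
  zero_mem' := ⟨IsHolomorphic.zero, by simp [hpNorm_zero]⟩
  add_mem' := fun hg hh =>
    ⟨hg.1.add hh.1, (hpNorm_add_le hg.1 hh.1).trans_lt (ENNReal.add_lt_top.2 ⟨hg.2, hh.2⟩)⟩
  smul_mem' := fun c g hg =>
    ⟨hg.1.smul c, by rw [hpNorm_smul]; exact ENNReal.mul_lt_top (by simp) hg.2⟩

/-- The Hardy space `H_p(𝔻^∞)` of holomorphic functions on `𝔻^∞ ∩ ℓ₂`. -/
def HpDisc (p : ℝ≥0∞) [Fact (1 ≤ p)] : Type := hpSubmodule p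

instance instAddCommGroupHpDisc (p : ℝ≥0∞) [Fact (1 ≤ p)] : AddCommGroup (HpDisc p) :=
  inferInstanceAs (AddCommGroup (hpSubmodule p))

instance instModuleHpDisc (p : ℝ≥0∞) [Fact (1 ≤ p)] : Module ℂ (HpDisc p) :=
  inferInstanceAs (Module ℂ (hpSubmodule p))

instance instCoeFunHpDisc (p : ℝ≥0∞) [Fact (1 ≤ p)] :
    CoeFun (HpDisc p) fun _ => polydisc → ℂ := ⟨fun g => g.1⟩

instance instIsHaarMeasureCircle : circleMeasure.IsHaarMeasure := by
  unfold circleMeasure; infer_instance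

theorem torusPoint_eq_zero {p : ℝ≥0∞} [hp : Fact (1 ≤ p)] {g : polydisc → ℂ}
    (hg : IsHolomorphic g) (h0 : hpNorm p g = 0) {n : ℕ} (r : Set.Ioo (0 : ℝ) 1)
    (w : Fin n → Circle) : g (torusPoint r w) = 0 := by
  have h1 : eLpNorm (fun w : Fin n → Circle => g (torusPoint r w)) p (torusMeasureFin n) = 0 :=
    le_antisymm ((eLpNorm_le_hpNorm p g n r).trans h0.le) bot_le
  rw [eLpNorm_eq_zero_iff (hg.aestronglyMeasurable r) (zero_lt_one.trans_le hp.out).ne'] at h1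
  have hc : Continuous fun w : Fin n → Circle => g (torusPoint r w) :=
    hg.continuous.comp (continuous_torusPoint r)
  exact congrFun (MeasureTheory.Measure.eq_of_ae_eq h1 hc continuous_const) w

theorem finPoint_eq_zero {p : ℝ≥0∞} [Fact (1 ≤ p)] {g : polydisc → ℂ} {G : ellTwo → ℂ}
    (hG : DifferentiableOn ℂ G polydisc) (hGg : ∀ z : polydisc, G z = g z)
    (h0 : hpNorm p g = 0) {n : ℕ} (r : Set.Ioo (0 : ℝ) 1) (s : Finset (Fin n)) :
    ∀ a : Fin n → ℂ, (∀ i ∈ s, ‖a i‖ ≤ r) → (∀ i ∉ s, ‖a i‖ = r) → G (finPoint a) = 0 := by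
  have hr0 : (0 : ℝ) < r := r.2.1
  induction s using Finset.induction_on with
  | empty =>
    intro a _ ha
    have hn : ∀ i, ‖a i / ((r : ℝ) : ℂ)‖ = 1 := fun i => by
      rw [norm_div, ha i (by simp), Complex.norm_real, Real.norm_of_nonneg hr0.le,
        div_self hr0.ne']
    let w : Fin n → Circle := fun i => ⟨a i / ((r : ℝ) : ℂ),
      mem_sphere_zero_iff_norm.2 (hn i)⟩
    have h1 := torusPoint_eq_zero ⟨G, hG, hGg⟩ h0 r w
    rw [← hGg] at h1
    have h2 : ((torusPoint r w : polydisc) : ellTwo) = finPoint a := by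
      change finPoint _ = finPoint a
      congr 1
      funext i
      exact mul_div_cancel₀ (a i) (Complex.ofReal_ne_zero.2 hr0.ne')
    rwa [h2] at h1
  | insert k s hk ih =>
    intro a ha hb
    have key : Set.EqOn (fun t : ℂ => G (finPoint (Function.update a k t))) (fun _ => 0)
        (closure (Metric.ball 0 (r : ℝ))) := by
      refine Complex.eqOn_closure_of_eqOn_frontier Metric.isBounded_ball ?_
        diffContOnCl_const ?_
      · refine DifferentiableOn.diffContOnCl ?_
        rw [closure_ball _ hr0.ne']
        refine hG.comp (f := fun t : ℂ => finPoint (Function.update a k t)) ?_ ?_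
        · refine Differentiable.differentiableOn ?_
          unfold finPoint
          refine Differentiable.fun_sum fun i _ => ?_
          have h1 : Differentiable ℂ fun t : ℂ => Function.update a k t i := by
            by_cases hik : i = k
            · subst hik; simp
            · simp [Function.update_of_ne hik]
          exact (lp.singleContinuousLinearMap ℂ (fun _ : ℕ => ℂ) 2 (i : ℕ)).differentiable.comp h1
        · intro t ht
          refine finPoint_mem fun i => ?_
          refine lt_of_le_of_lt ?_ r.2.2
          by_cases hik : i = k
          · subst hik; simpa using ht
          · rw [Function.update_of_ne hik]
            by_cases his : i ∈ insert k s
            · exact ha i his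
            · exact (hb i his).le
      · intro t ht
        rw [frontier_ball _ hr0.ne'] at ht
        refine ih _ (fun i hi => ?_) (fun i hi => ?_)
        · have hik : i ≠ k := fun h => hk (h ▸ hi)
          rw [Function.update_of_ne hik]
          exact ha i (Finset.mem_insert_of_mem hi)
        · by_cases hik : i = k
          · subst hik; simpa using ht
          · rw [Function.update_of_ne hik]
            exact hb i (by simp [hik, hi])
    have h1 := key (x := a k) (by
      rw [closure_ball _ hr0.ne']
      simpa using ha k (Finset.mem_insert_self k s))
    simpa using h1

theorem eq_zero_of_hpNorm_eq_zero {p : ℝ≥0∞} [Fact (1 ≤ p)] {g : polydisc → ℂ}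
    (hg : IsHolomorphic g) (h0 : hpNorm p g = 0) : g = 0 := by
  obtain ⟨G, hG, hGg⟩ := hg
  funext z
  have hz : ∀ n : ℕ, G (finPoint fun i : Fin n => (z : ellTwo) i) = 0 := fun n => by
    have h1 : ∀ᶠ r : ℝ in nhdsWithin 1 (Set.Iio 1), ∀ i : Fin n, ‖(z : ellTwo) i‖ ≤ r :=
      Filter.eventually_all.2 fun i =>
        ((lt_mem_nhds (z.2 i)).filter_mono nhdsWithin_le_nhds).mono fun _ h => h.le
    have h2 : ∀ᶠ r : ℝ in nhdsWithin 1 (Set.Iio 1), 0 < r :=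
      (lt_mem_nhds zero_lt_one).filter_mono nhdsWithin_le_nhds
    obtain ⟨r, hr, hr0, hr1⟩ := (h1.and (h2.and self_mem_nhdsWithin)).exists
    exact finPoint_eq_zero hG hGg h0 ⟨r, hr0, hr1⟩ Finset.univ _ (fun i _ => hr i)
      (fun i hi => absurd (Finset.mem_univ i) hi)
  have hlim : Filter.Tendsto (fun n : ℕ => finPoint fun i : Fin n => (z : ellTwo) i) Filter.atTop
      (nhds (z : ellTwo)) := by
    have h1 := (lp.hasSum_single (E := fun _ : ℕ => ℂ) (p := 2) (by simp)
      (z : ellTwo)).tendsto_sum_nat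
    refine h1.congr fun n => ?_
    exact (Fin.sum_univ_eq_sum_range
      (fun i => lp.single (E := fun _ : ℕ => ℂ) 2 i ((z : ellTwo) i)) n).symm
  have hmem : ∀ n : ℕ, (finPoint fun i : Fin n => (z : ellTwo) i) ∈ polydisc := fun n =>
    finPoint_mem fun i => z.2 i
  have hc : Filter.Tendsto (fun n : ℕ => G (finPoint fun i : Fin n => (z : ellTwo) i)) Filter.atTop
      (nhds (G z)) :=
    (hG.continuousOn z z.2).tendsto.comp
      (tendsto_nhdsWithin_iff.2 ⟨hlim, Filter.Eventually.of_forall hmem⟩)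
  simp only [hz] at hc
  rw [← hGg z, Pi.zero_apply]
  exact tendsto_nhds_unique hc tendsto_const_nhds

theorem hpNorm_neg (p : ℝ≥0∞) (g : polydisc → ℂ) : hpNorm p (-g) = hpNorm p g := by
  have h := hpNorm_smul p (-1) g
  simpa using h

/-- `H_p(𝔻^∞)` with the norm
`‖g‖ = sup_n sup_{0<r<1} (∫_{𝕋ⁿ} |g(r w_1, …, r w_n, 0, …)|^p dm_n(w))^{1/p}`. -/
instance instNormedAddCommGroupHpDisc (p : ℝ≥0∞) [Fact (1 ≤ p)] :
    NormedAddCommGroup (HpDisc p) :=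
  AddGroupNorm.toNormedAddCommGroup
    { toFun := fun g => (hpNorm p g).toReal
      map_zero' := by
        change (hpNorm p 0).toReal = 0
        rw [hpNorm_zero, ENNReal.toReal_zero]
      add_le' := fun g h => by
        rw [← ENNReal.toReal_add g.2.2.ne h.2.2.ne]
        exact ENNReal.toReal_mono (ENNReal.add_ne_top.2 ⟨g.2.2.ne, h.2.2.ne⟩)
          (hpNorm_add_le g.2.1 h.2.1)
      neg' := fun g => congrArg ENNReal.toReal (hpNorm_neg p g)
      eq_zero_of_map_eq_zero' := fun g hg => by
        rcases (ENNReal.toReal_eq_zero_iff _).1 hg with h | h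
        · exact Subtype.ext (eq_zero_of_hpNorm_eq_zero g.2.1 h)
        · exact absurd h g.2.2.ne }

theorem norm_hpDisc_def {p : ℝ≥0∞} [Fact (1 ≤ p)] (g : HpDisc p) :
    ‖g‖ = (hpNorm p g).toReal := rfl

instance instNormedSpaceHpDisc (p : ℝ≥0∞) [Fact (1 ≤ p)] : NormedSpace ℂ (HpDisc p) where
  norm_smul_le c g := by
    have h : hpNorm p (c • g : HpDisc p) = ‖c‖ₑ * hpNorm p g := hpNorm_smul p c g
    rw [norm_hpDisc_def, norm_hpDisc_def, h, ENNReal.toReal_mul, toReal_enorm]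

/-- The monomial `z^α = ∏ z_i^{α_i}` on `𝔻^∞ ∩ ℓ₂`. -/
def discMonomial (α : ℕ →₀ ℕ) (z : polydisc) : ℂ :=
  α.prod fun i k => (z : ellTwo) i ^ k

theorem isHolomorphic_discMonomial (α : ℕ →₀ ℕ) : IsHolomorphic (discMonomial α) := by
  refine ⟨fun z => ∏ i ∈ α.support, z i ^ α i, ?_, fun z => rfl⟩
  have h : ∀ i, Differentiable ℂ fun z : ellTwo => z i := fun i =>
    (lp.evalCLM ℂ (fun _ : ℕ => ℂ) 2 i).differentiable
  have h2 : Differentiable ℂ fun z : ellTwo => ∏ i ∈ α.support, z i ^ α i :=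
    fun z => (HasFDerivAt.finsetProd fun i _ =>
      ((h i).fun_pow (α i) z).hasFDerivAt).differentiableAt
  exact h2.differentiableOn

theorem norm_discMonomial_le (α : ℕ →₀ ℕ) (z : polydisc) : ‖discMonomial α z‖ ≤ 1 := by
  rw [discMonomial, Finsupp.prod, norm_prod]
  refine Finset.prod_le_one (fun _ _ => norm_nonneg _) fun i _ => ?_
  rw [norm_pow]
  exact pow_le_one₀ (norm_nonneg _) (z.2 i).le

theorem hpNorm_discMonomial_lt (p : ℝ≥0∞) (α : ℕ →₀ ℕ) : hpNorm p (discMonomial α) < ∞ := by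
  refine lt_of_le_of_lt (b := 1) (iSup₂_le fun n r => ?_) ENNReal.one_lt_top
  refine (eLpNorm_le_of_ae_bound (C := 1)
    (Filter.Eventually.of_forall fun w => norm_discMonomial_le α _)).trans ?_
  simp

/-- The monomial `z^α` as an element of `H_p(𝔻^∞)`. -/
def hpMonomial (p : ℝ≥0∞) [Fact (1 ≤ p)] (α : ℕ →₀ ℕ) : HpDisc p :=
  ⟨discMonomial α, isHolomorphic_discMonomial α, hpNorm_discMonomial_lt p α⟩

end HardyInf

end

noncomputable section

namespace HardyInf

/-! The crux is a coefficient bound for analytic polynomials: if `0 ≤ x i ≤ s < 1`, then `∑ |a_α|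
x^α ≤ exp (C_s ∑ x_i²) ‖P‖₁` with `C_s = 2 / (1 - s)²`, whatever the number of variables. In one
variable it comes from pairing `P` with a test function of modulus at most `exp (C_s ρ²)`
(`sum_coeff_le_integral`); treating the variables one at a time multiplies the constants
(`sum_prod_coeff_le_integral`). The exponent is quadratic in the radius, so the product stays
bounded for weights in `ℓ₂`.

Analytic polynomials are dense in `H_p(𝕋^∞)` (`dense_span_hpTorusMonomial`): convolve with an
approximate identity and replace its kernel by a trigonometric polynomial. The bound therefore
passes to every `f`. It gives absolute convergence and locally uniform control of point evaluations,
so `φ(f)` is locally a uniform limit of polynomials and is holomorphic.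

Shrinking the radius of one coordinate is a Poisson average, that is, an average of translates, and
contracts `L_p`; hence `‖φ(f)‖ ≤ ‖f‖`. For polynomials, Fatou's lemma as the radii tend to `1` gives
the converse, and density gives the isometry. The range is closed by completeness, so it is the
closure of the span of the monomials.

For `1 < p`, the restrictions of `g` to the tori of radius `r_k → 1` in `k` variables are bounded in
`L_p` and have a weak limit `f` along an ultrafilter (`exists_weak_limit_of_eLpNorm_le`). The
coefficients of `g` on tori of different radii differ by powers of the radii
(`fourierCoeff_torusPoint`), so in the limit they are expressed through those of `f`. Then `φ(f)`
and `g` have the same coefficients on every torus, and uniqueness yields `φ(f) = g`. -/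

instance instIsMulLeftInvariantTorus : torusMeasure.IsMulLeftInvariant where
  map_mul_left_eq_self g := by
    have h := Measure.infinitePi_map_pi (μ := fun _ : ℕ => circleMeasure)
      (f := fun i (x : Circle) => g i * x) (fun i => by fun_prop)
    change Measure.map (fun w i => g i * w i) torusMeasure = _
    refine h.trans ?_
    congr 1
    funext i
    exact map_mul_left_eq_self circleMeasure (g i)

/-! ### Averages of translates on the infinite torus -/

section Average

variable {X : Type*} [MeasurableSpace X] {ν : Measure X} [IsProbabilityMeasure ν]
  {θ : X → ℕ → Circle}

/-- For each fixed `x` the slice is a translation by `θ x`, which preserves the measure; Fubini does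
the rest. All later averaging over a single coordinate, or against a convolution kernel, is an
instance of this. -/
theorem measurePreserving_mul (hθ : Measurable θ) :
    MeasurePreserving (fun q : (ℕ → Circle) × X => q.1 * θ q.2) (torusMeasure.prod ν)
      torusMeasure := by
  have hm : Measurable fun q : (ℕ → Circle) × X => q.1 * θ q.2 := by fun_prop
  refine ⟨hm, ?_⟩
  ext s hs
  rw [Measure.map_apply hm hs, Measure.prod_apply_symm (hm hs)]
  have h : ∀ x, torusMeasure ((fun w => (w, x)) ⁻¹'
      ((fun q : (ℕ → Circle) × X => q.1 * θ q.2) ⁻¹' s)) = torusMeasure s := fun x =>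
    measure_preimage_mul_right torusMeasure (θ x) s
  simp [h]

theorem integral_integral_mul {E : Type*} [NormedAddCommGroup E] [NormedSpace ℝ E]
    {u : (ℕ → Circle) → E} (hu : Integrable u torusMeasure)
    (hθ : Measurable θ) : ∫ w, ∫ x, u (w * θ x) ∂ν ∂torusMeasure = ∫ w, u w ∂torusMeasure := by
  have hmp := measurePreserving_mul (ν := ν) hθ
  rw [integral_integral (f := fun w x => u (w * θ x)) (hmp.integrable_comp_of_integrable hu)]
  have h := hmp.map_eq
  conv_rhs => rw [← h]
  rw [integral_map hmp.measurable.aemeasurable (by rw [h]; exact hu.1)]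

theorem lintegral_lintegral_mul {u : (ℕ → Circle) → ℝ≥0∞} (hu : Measurable u)
    (hθ : Measurable θ) : ∫⁻ w, ∫⁻ x, u (w * θ x) ∂ν ∂torusMeasure = ∫⁻ w, u w ∂torusMeasure := by
  have hmp := measurePreserving_mul (ν := ν) hθ
  rw [lintegral_lintegral (f := fun w x => u (w * θ x))]
  · exact hmp.lintegral_comp hu
  · exact (hu.comp hmp.measurable).aemeasurable

/-- Averaging translates of a function does not increase its `L_p` norm. -/
theorem eLpNorm_average_le {p : ℝ≥0∞} (hp1 : 1 ≤ p) (hp : p ≠ ∞) {f : (ℕ → Circle) → ℂ}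
    (hf : StronglyMeasurable f) (hθ : Measurable θ) :
    eLpNorm (fun w => ∫ x, f (w * θ x) ∂ν) p torusMeasure ≤ eLpNorm f p torusMeasure := by
  have hp0 : p ≠ 0 := (zero_lt_one.trans_le hp1).ne'
  have hpr : 0 < p.toReal := ENNReal.toReal_pos hp0 hp
  rw [eLpNorm_eq_lintegral_rpow_enorm_toReal hp0 hp, eLpNorm_eq_lintegral_rpow_enorm_toReal hp0 hp]
  refine ENNReal.rpow_le_rpow ?_ (by positivity)
  rw [← lintegral_lintegral_mul (ν := ν) (θ := θ) (hf.enorm.pow_const _) hθ]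
  refine lintegral_mono fun w => ?_
  -- Jensen's inequality, in the form `L_1 ≤ L_p` on a probability space.
  have h1 : ‖∫ x, f (w * θ x) ∂ν‖ₑ ≤ eLpNorm (fun x => f (w * θ x)) p ν := by
    refine (enorm_integral_le_lintegral_enorm _).trans ?_
    rw [← eLpNorm_one_eq_lintegral_enorm]
    refine eLpNorm_le_eLpNorm_of_exponent_le hp1 ?_
    exact (hf.comp_measurable (by fun_prop)).aestronglyMeasurable
  refine (ENNReal.rpow_le_rpow h1 hpr.le).trans ?_
  rw [eLpNorm_eq_lintegral_rpow_enorm_toReal hp0 hp, ← ENNReal.rpow_mul, one_div,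
    inv_mul_cancel₀ hpr.ne', ENNReal.rpow_one]

end Average

/-! ### Finite-dimensional projections and integrals over the circle -/

/-- The projection of `𝕋^∞` onto the first `n` coordinates. -/
def torusRestrict (n : ℕ) (w : ℕ → Circle) : Fin n → Circle := fun i => w i

theorem continuous_torusRestrict (n : ℕ) : Continuous (torusRestrict n) := by
  unfold torusRestrict; fun_prop

/-- It lets every integral over `𝕋ⁿ` be computed on `𝕋^∞`, so that different numbers of variables
can be compared in a single space. -/
theorem measurePreserving_torusRestrict (n : ℕ) :
    MeasurePreserving (torusRestrict n) torusMeasure (torusMeasureFin n) := by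
  refine ⟨(continuous_torusRestrict n).measurable, (Measure.pi_eq fun s hs => ?_).symm⟩
  rw [Measure.map_apply (continuous_torusRestrict n).measurable
    (MeasurableSet.univ_pi hs)]
  have h : torusRestrict n ⁻¹' Set.univ.pi s = Set.pi (Finset.range n : Set ℕ)
      (fun i => if h : i < n then s ⟨i, h⟩ else Set.univ) := by
    ext w
    simp only [torusRestrict, Set.mem_preimage, Set.mem_pi, Set.mem_univ, forall_const,
      Finset.coe_range, Set.mem_Iio]
    refine ⟨fun h i hi => by simpa [hi] using h ⟨i, hi⟩, fun h i => by simpa using h i i.2⟩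
  rw [h, Measure.infinitePi_pi, ← Fin.prod_univ_eq_prod_range]
  · simp
  · intro i hi
    have : i < n := by simpa using hi
    simpa [this] using hs _

/-- Rotation by `exp (πi / k)` preserves the measure and changes the sign of the integrand. -/
theorem integral_zpow_circle {k : ℤ} (hk : k ≠ 0) :
    ∫ v : Circle, ((v ^ k : Circle) : ℂ) ∂circleMeasure = 0 := by
  have hc : Circle.exp (Real.pi / k) ^ k = -1 := by
    rw [← Circle.exp_zsmul, zsmul_eq_mul, mul_div_cancel₀ _ (Int.cast_ne_zero.2 hk)]
    ext; simp
  have h := integral_mul_left_eq_self (μ := circleMeasure)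
    (fun v : Circle => ((v ^ k : Circle) : ℂ)) (Circle.exp (Real.pi / k))
  simp only [mul_zpow, hc, Circle.coe_neg, neg_mul, one_mul,
    integral_neg] at h
  exact self_eq_neg.1 h.symm

theorem integral_pow_mul_conj_pow (j k : ℕ) :
    ∫ v : Circle, (v : ℂ) ^ j * (starRingEnd ℂ (v : ℂ)) ^ k ∂circleMeasure
      = if j = k then 1 else 0 := by
  have h : ∀ v : Circle, (v : ℂ) ^ j * (starRingEnd ℂ (v : ℂ)) ^ k
      = ((v ^ ((j : ℤ) - k) : Circle) : ℂ) := fun v => by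
    rw [← Circle.coe_inv_eq_conj, zpow_sub, zpow_natCast, zpow_natCast]
    simp
  simp only [h]
  split_ifs with hjk
  · simp [hjk]
  · exact integral_zpow_circle (by omega)

/-- The mean value property on the unit circle with its Haar measure. -/
theorem integral_circle_eq {F : ℂ → ℂ} (hF : DiffContOnCl ℂ F (Metric.ball 0 1)) :
    ∫ v : Circle, F v ∂circleMeasure = F 0 := by
  have hcont : ContinuousOn F (Metric.closedBall 0 1) := by
    have := hF.continuousOn
    rwa [closure_ball _ one_ne_zero] at this
  obtain ⟨C, hC⟩ := (isCompact_closedBall (0 : ℂ) 1).exists_bound_of_continuousOn hcont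
  have hmem : ∀ v c : Circle, (v : ℂ) * (c : ℂ) ∈ Metric.closedBall (0 : ℂ) 1 := fun v c => by
    simp [Circle.norm_coe]
  have hc2 : Continuous fun q : Circle × ℝ => F ((q.1 : ℂ) * (Circle.exp q.2 : ℂ)) :=
    hcont.comp_continuous (by fun_prop) fun q => hmem _ _
  let μ : Measure ℝ := volume.restrict (Set.Ioc 0 (2 * Real.pi))
  have hint : Integrable (Function.uncurry fun (v : Circle) (t : ℝ) =>
      F ((v : ℂ) * (Circle.exp t : ℂ))) (circleMeasure.prod μ) := by
    refine Integrable.of_bound hc2.aestronglyMeasurable C ?_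
    exact Filter.Eventually.of_forall fun q => hC _ (hmem _ _)
  -- The function `F (v e^{it})` is integrated in both orders: over `t` first, the mean value
  -- property gives `2π F 0`; over `v` first, invariance gives the Haar integral for every `t`. Thus
  -- the Haar measure need not be identified with `dt / 2π`.
  have hswap := integral_integral_swap hint
  have h1 : ∀ v : Circle, ∫ t, F ((v : ℂ) * (Circle.exp t : ℂ)) ∂μ = (2 * Real.pi) • F 0 := by
    intro v
    have hd : DiffContOnCl ℂ (fun z => F ((v : ℂ) * z)) (Metric.ball 0 |1|) := by
      refine hF.comp (g := fun z => (v : ℂ) * z) ?_ ?_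
      · exact (differentiable_id.const_mul (v : ℂ)).diffContOnCl
      · intro z hz
        simpa [Circle.norm_coe] using hz
    have h := hd.circleAverage
    rw [Real.circleAverage_def, intervalIntegral.integral_of_le Real.two_pi_pos.le] at h
    simp only [mul_zero] at h
    rw [← h, smul_inv_smul₀ Real.two_pi_pos.ne']
    simp [circleMap, μ]
  have h2 : ∀ t : ℝ, ∫ v : Circle, F ((v : ℂ) * (Circle.exp t : ℂ)) ∂circleMeasure
      = ∫ v : Circle, F v ∂circleMeasure := fun t => by
    have := integral_mul_right_eq_self (μ := circleMeasure) (fun v : Circle => F (v : ℂ))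
      (Circle.exp t)
    simpa using this
  simp only [h1, h2, integral_const] at hswap
  have hμ : μ.real Set.univ = 2 * Real.pi := by
    simp [μ, Measure.real, Real.pi_pos.le]
  rw [hμ, probReal_univ, one_smul] at hswap
  exact (smul_right_injective ℂ Real.two_pi_pos.ne' hswap).symm

/-! ### The weighted coefficient bound in one variable -/

theorem exists_norm_one_conj_mul (z : ℂ) :
    ∃ e : ℂ, ‖e‖ = 1 ∧ starRingEnd ℂ e * z = ‖z‖ := by
  by_cases hz : z = 0
  · exact ⟨1, by simp, by simp [hz]⟩
  · have h0 : (‖z‖ : ℂ) ≠ 0 := by simpa using hz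
    refine ⟨z / ‖z‖, by simp [hz], ?_⟩
    rw [map_div₀, Complex.conj_ofReal, div_mul_eq_mul_div, mul_comm, Complex.mul_conj,
      Complex.normSq_eq_norm_sq]
    push_cast
    field_simp

/-- Here `1 + conj g - g = 1 - 2i Im g` has squared modulus `1 + 4 (Im g)²`, so the excess over `1`
is quadratic in `c`. With `1 + conj g` alone it would be linear, and a product over `ℓ₂` weights
could diverge. -/
theorem norm_one_add_conj_sub_le (g : ℂ) {c : ℝ} (hg : ‖g‖ ≤ c) :
    ‖1 + starRingEnd ℂ g - g‖ ≤ Real.exp (2 * c ^ 2) := by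
  have h1 : ‖1 + starRingEnd ℂ g - g‖ ^ 2 = 1 + 4 * g.im ^ 2 := by
    rw [← Complex.normSq_eq_norm_sq, Complex.normSq_apply]
    simp
    ring
  have h2 : g.im ^ 2 ≤ c ^ 2 := by
    rw [← sq_abs]
    exact pow_le_pow_left₀ (abs_nonneg _) ((Complex.abs_im_le_norm g).trans hg) 2
  refine le_of_sq_le_sq ?_ (Real.exp_pos _).le
  rw [h1, ← Real.exp_nat_mul]
  have := Real.add_one_le_exp (((2 : ℕ) : ℝ) * (2 * c ^ 2))
  push_cast at this ⊢
  linarith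

/-- A weighted `ℓ₁` bound for the coefficients of an analytic polynomial by its `L₁` norm. -/
theorem sum_coeff_le_integral {s ρ : ℝ} (hs : s < 1) (h0 : 0 ≤ ρ) (hρ : ρ ≤ s) (b : ℕ → ℂ)
    (N : ℕ) :
    ∑ k ∈ Finset.range (N + 1), ρ ^ k * ‖b k‖ ≤ Real.exp (2 / (1 - s) ^ 2 * ρ ^ 2) *
      ∫ v : Circle, ‖∑ k ∈ Finset.range (N + 1), b k * (v : ℂ) ^ k‖ ∂circleMeasure := by
  choose e he1 he using fun k => exists_norm_one_conj_mul (b k)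
  set h : ℂ → ℂ := fun t => ∑ k ∈ Finset.range (N + 1), b k * t ^ k with hh
  -- Pairing `h` with `conj g` produces `∑ ρ^k |b k|` over `k ≥ 1`, up to the common phase `e 0`.
  -- Since `g` starts in degree one, `h g` has mean zero, so `-g` can be added to the test function
  -- at no cost.
  set g : ℂ → ℂ := fun t => ∑ k ∈ Finset.range N,
    (ρ : ℂ) ^ (k + 1) * (e (k + 1) * starRingEnd ℂ (e 0)) * t ^ (k + 1) with hg
  have hhd : Differentiable ℂ h := by fun_prop
  have hgd : Differentiable ℂ g := by fun_prop
  have hρ1 : ρ < 1 := hρ.trans_lt hs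
  -- The absence of a constant term leaves a factor `ρ` in front of the geometric series; squared,
  -- it becomes the `ρ ^ 2` in the exponent.
  have hgb : ∀ v : Circle, ‖g v‖ ≤ ρ / (1 - s) := fun v => by
    refine (norm_sum_le _ _).trans ?_
    have : ∀ k ∈ Finset.range N, ‖(ρ : ℂ) ^ (k + 1) * (e (k + 1) * starRingEnd ℂ (e 0)) *
        (v : ℂ) ^ (k + 1)‖ = ρ * ρ ^ k := fun k _ => by
      simp [he1, abs_of_nonneg h0, pow_succ', Circle.norm_coe]
    rw [Finset.sum_congr rfl this, ← Finset.mul_sum, div_eq_mul_inv]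
    refine mul_le_mul_of_nonneg_left ?_ h0
    refine (Summable.sum_le_tsum (f := fun k => ρ ^ k) _ (fun _ _ => by positivity)
      (summable_geometric_of_lt_one h0 hρ1)).trans ?_
    rw [tsum_geometric_of_lt_one h0 hρ1]
    exact inv_anti₀ (by linarith) (by linarith)
  have hhc : Continuous fun v : Circle => h v := hhd.continuous.comp continuous_subtype_val
  have hgc : Continuous fun v : Circle => g v := hgd.continuous.comp continuous_subtype_val
  have hint : ∀ {u : Circle → ℂ}, Continuous u → Integrable u circleMeasure := fun hu =>
    hu.integrable_of_hasCompactSupport (HasCompactSupport.of_compactSpace _)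
  have i1 : ∫ v : Circle, h v ∂circleMeasure = b 0 := by
    rw [integral_circle_eq hhd.diffContOnCl]
    simp [hh, Finset.sum_range_succ']
  have i2 : ∫ v : Circle, h v * g v ∂circleMeasure = 0 := by
    rw [integral_circle_eq (F := fun t => h t * g t) (hhd.mul hgd).diffContOnCl]
    simp [hg]
  have i3 : ∫ v : Circle, h v * starRingEnd ℂ (g v) ∂circleMeasure
      = ∑ k ∈ Finset.range N, (ρ : ℂ) ^ (k + 1) * (starRingEnd ℂ (e (k + 1)) * e 0) * b (k + 1) := by
    have : ∀ v : Circle, h v * starRingEnd ℂ (g v) = ∑ k ∈ Finset.range N,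
        ∑ j ∈ Finset.range (N + 1), (ρ : ℂ) ^ (k + 1) * (starRingEnd ℂ (e (k + 1)) * e 0) * b j *
          ((v : ℂ) ^ j * (starRingEnd ℂ (v : ℂ)) ^ (k + 1)) := fun v => by
      simp only [hh, hg, map_sum, map_mul, map_pow, Complex.conj_ofReal, Complex.conj_conj,
        Finset.sum_mul_sum]
      rw [Finset.sum_comm]
      refine Finset.sum_congr rfl fun k _ => Finset.sum_congr rfl fun j _ => by ring
    simp only [this]
    rw [integral_finsetSum _ fun k _ => hint (by fun_prop)]
    refine Finset.sum_congr rfl fun k hk => ?_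
    rw [integral_finsetSum _ fun k _ => hint (by fun_prop)]
    simp only [integral_const_mul, integral_pow_mul_conj_pow]
    rw [Finset.sum_eq_single (k + 1)]
    · simp
    · intro j _ hj; simp [hj]
    · intro hk'; simp at hk hk'; omega
  have key : ((∑ k ∈ Finset.range (N + 1), ρ ^ k * ‖b k‖ : ℝ) : ℂ)
      = ∫ v : Circle, h v * (starRingEnd ℂ (e 0) * (1 + starRingEnd ℂ (g v) - g v))
        ∂circleMeasure := by
    have : ∀ v : Circle, h v * (starRingEnd ℂ (e 0) * (1 + starRingEnd ℂ (g v) - g v))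
        = starRingEnd ℂ (e 0) * (h v + h v * starRingEnd ℂ (g v) - h v * g v) := fun v => by ring
    simp only [this]
    rw [integral_const_mul, integral_sub (hint (by fun_prop)) (hint (by fun_prop)),
      integral_add (hint (by fun_prop)) (hint (by fun_prop)), i1, i2, i3, Finset.sum_range_succ']
    have he0 : starRingEnd ℂ (e 0) * e 0 = 1 := by
      rw [mul_comm, Complex.mul_conj, Complex.normSq_eq_norm_sq, he1]; simp
    push_cast
    rw [sub_zero, mul_add, Finset.mul_sum, he, add_comm, pow_zero, one_mul]
    congr 1
    refine Finset.sum_congr rfl fun k _ => ?_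
    rw [← he]
    linear_combination (-(ρ : ℂ) ^ (k + 1) * (starRingEnd ℂ (e (k + 1)) * b (k + 1))) * he0
  have hnn : 0 ≤ ∑ k ∈ Finset.range (N + 1), ρ ^ k * ‖b k‖ :=
    Finset.sum_nonneg fun _ _ => by positivity
  have hn := congrArg norm key
  rw [Complex.norm_real, Real.norm_of_nonneg hnn] at hn
  rw [hn, ← integral_const_mul]
  refine norm_integral_le_of_norm_le ?_ (Filter.Eventually.of_forall fun v => ?_)
  · exact (((hint hhc).norm).const_mul _)
  · rw [norm_mul, norm_mul, RCLike.norm_conj, he1, one_mul, mul_comm]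
    refine mul_le_mul_of_nonneg_right ?_ (norm_nonneg _)
    refine (norm_one_add_conj_sub_le _ (hgb v)).trans (le_of_eq ?_)
    congr 1
    rw [div_pow]; ring

/-! ### Blaschke factors and Poisson averages -/

/-- The Blaschke factor `v ↦ (v + ρ) / (1 + ρ v)` on the closed unit disc. -/
def blaschke (ρ : ℝ) (t : ℂ) : ℂ := (t + ρ) / (1 + ρ * t)

theorem one_add_mul_ne_zero {ρ : ℝ} (h0 : 0 ≤ ρ) (h1 : ρ < 1) {t : ℂ} (ht : ‖t‖ ≤ 1) :
    1 + (ρ : ℂ) * t ≠ 0 := fun h => by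
  have h2 : ‖(ρ : ℂ) * t‖ = 1 := by
    rw [show (ρ : ℂ) * t = -1 by linear_combination h]; simp
  rw [norm_mul, Complex.norm_real, Real.norm_of_nonneg h0] at h2
  nlinarith [norm_nonneg t]

/-- The sign of the right-hand side decides both that the Blaschke factor maps the closed disc into
itself and that it preserves the circle. -/
theorem normSq_blaschke (ρ : ℝ) (t : ℂ) :
    Complex.normSq (1 + ρ * t) - Complex.normSq (t + ρ)
      = (1 - ρ ^ 2) * (1 - Complex.normSq t) := by
  simp [Complex.normSq_apply]
  ring

theorem norm_blaschke_le {ρ : ℝ} (h0 : 0 ≤ ρ) (h1 : ρ < 1) {t : ℂ} (ht : ‖t‖ ≤ 1) :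
    ‖blaschke ρ t‖ ≤ 1 := by
  rw [blaschke, norm_div]
  refine div_le_one_of_le₀ ?_ (norm_nonneg _)
  refine le_of_sq_le_sq ?_ (norm_nonneg _)
  have h := normSq_blaschke ρ t
  simp only [Complex.normSq_eq_norm_sq] at h
  nlinarith [mul_nonneg (show 0 ≤ 1 - ρ ^ 2 by nlinarith)
    (show 0 ≤ 1 - ‖t‖ ^ 2 by nlinarith [norm_nonneg t])]

theorem norm_blaschke_eq {ρ : ℝ} (h0 : 0 ≤ ρ) (h1 : ρ < 1) {t : ℂ} (ht : ‖t‖ = 1) :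
    ‖blaschke ρ t‖ = 1 := by
  rw [blaschke, norm_div, div_eq_one_iff_eq (norm_ne_zero_iff.2 (one_add_mul_ne_zero h0 h1 ht.le))]
  have h := normSq_blaschke ρ t
  simp only [Complex.normSq_eq_norm_sq, ht] at h
  refine (pow_left_inj₀ (norm_nonneg _) (norm_nonneg _) two_ne_zero).1 ?_
  linarith

theorem continuousOn_blaschke {ρ : ℝ} (h0 : 0 ≤ ρ) (h1 : ρ < 1) :
    ContinuousOn (blaschke ρ) (Metric.closedBall 0 1) :=
  ContinuousOn.div (by fun_prop) (by fun_prop) fun _ ht =>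
    one_add_mul_ne_zero h0 h1 (mem_closedBall_zero_iff.1 ht)

theorem differentiableOn_blaschke {ρ : ℝ} (h0 : 0 ≤ ρ) (h1 : ρ < 1) :
    DifferentiableOn ℂ (blaschke ρ) (Metric.closedBall 0 1) :=
  DifferentiableOn.div (by fun_prop) (by fun_prop) fun _ ht =>
    one_add_mul_ne_zero h0 h1 (mem_closedBall_zero_iff.1 ht)

/-- The Blaschke factor as a self map of the unit circle. -/
def circleBlaschke (ρ : Set.Ico (0 : ℝ) 1) (v : Circle) : Circle :=
  ⟨blaschke ρ v, mem_sphere_zero_iff_norm.2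
    (norm_blaschke_eq ρ.2.1 ρ.2.2 (Circle.norm_coe v))⟩

theorem continuous_circleBlaschke (ρ : Set.Ico (0 : ℝ) 1) : Continuous (circleBlaschke ρ) :=
  Continuous.subtype_mk ((continuousOn_blaschke ρ.2.1 ρ.2.2).comp_continuous
    continuous_subtype_val fun v =>
      mem_closedBall_zero_iff.2 (Circle.norm_coe v).le) _

/-- The Poisson formula in terms of Blaschke factors. -/
theorem integral_circleBlaschke {F : ℂ → ℂ} (hF : DifferentiableOn ℂ F (Metric.closedBall 0 1))
    (ρ : Set.Ico (0 : ℝ) 1) :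
    ∫ v : Circle, F (circleBlaschke ρ v) ∂circleMeasure = F ((ρ : ℝ) : ℂ) := by
  have h : DifferentiableOn ℂ (fun t => F (blaschke ρ t)) (Metric.closedBall 0 1) :=
    hF.comp (differentiableOn_blaschke ρ.2.1 ρ.2.2) fun t ht => mem_closedBall_zero_iff.2
      (norm_blaschke_le ρ.2.1 ρ.2.2 (mem_closedBall_zero_iff.1 ht))
  have h2 := integral_circle_eq (DifferentiableOn.diffContOnCl (by
    rwa [closure_ball _ one_ne_zero]) : DiffContOnCl ℂ (fun t => F (blaschke ρ t))
      (Metric.ball 0 1))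
  have h3 : blaschke ρ 0 = ((ρ : ℝ) : ℂ) := by simp [blaschke]
  rw [h3] at h2
  exact h2

/-! ### Analytic polynomials in infinitely many variables and their coefficient bound -/

theorem integrable_of_continuous {E : Type*} [NormedAddCommGroup E] [SecondCountableTopology E]
    {u : (ℕ → Circle) → E} (hu : Continuous u) : Integrable u torusMeasure := by
  obtain ⟨C, hC⟩ := isCompact_univ.exists_bound_of_continuousOn hu.continuousOn
  exact Integrable.of_bound hu.aestronglyMeasurable C
    (Filter.Eventually.of_forall fun w => hC w (Set.mem_univ w))

/-- The monomial `y^α` in a sequence of complex variables. -/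
def seqMonomial (α : ℕ →₀ ℕ) (y : ℕ → ℂ) : ℂ := α.prod fun i k => y i ^ k

/-- The complex coordinates of a point of the infinite torus. -/
def torusCoe (w : ℕ → Circle) : ℕ → ℂ := fun i => w i

theorem continuous_torusCoe : Continuous torusCoe := by
  unfold torusCoe; fun_prop

theorem continuous_seqMonomial (α : ℕ →₀ ℕ) : Continuous (seqMonomial α) := by
  unfold seqMonomial Finsupp.prod; fun_prop

theorem seqMonomial_eq_prod {α : ℕ →₀ ℕ} {S : Finset ℕ} (h : α.support ⊆ S) (y : ℕ → ℂ) :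
    seqMonomial α y = ∏ i ∈ S, y i ^ α i :=
  Finsupp.prod_of_support_subset _ h _ fun _ _ => pow_zero _

theorem seqMonomial_mul (α : ℕ →₀ ℕ) (y z : ℕ → ℂ) :
    seqMonomial α (fun i => y i * z i) = seqMonomial α y * seqMonomial α z := by
  simp [seqMonomial, Finsupp.prod, mul_pow, Finset.prod_mul_distrib]

theorem norm_seqMonomial_torusCoe (α : ℕ →₀ ℕ) (w : ℕ → Circle) :
    ‖seqMonomial α (torusCoe w)‖ = 1 := by
  simp [seqMonomial, Finsupp.prod, torusCoe, norm_prod, Circle.norm_coe]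

theorem seqMonomial_torusCoe (α : ℕ →₀ ℕ) (w : ℕ → Circle) :
    seqMonomial α (torusCoe w) = (torusMonomial (natIndex α) w : ℂ) := by
  rw [torusMonomial, natIndex, Finsupp.prod_mapRange_index (by simp), seqMonomial, Finsupp.prod,
    Finsupp.prod]
  refine Eq.trans ?_ (map_prod Circle.coeHom _ _).symm
  simp only [torusCoe, zpow_natCast]
  rfl

theorem seqMonomial_update_one (α : ℕ →₀ ℕ) (i : ℕ) (t : ℂ) :
    seqMonomial α (Function.update 1 i t) = t ^ α i := by
  by_cases hi : i ∈ α.support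
  · rw [seqMonomial, Finsupp.prod, Finset.prod_eq_single_of_mem i hi]
    · simp
    · intro j _ hj
      simp [Function.update_of_ne hj]
  · have hi0 : α i = 0 := by simpa using hi
    rw [hi0, pow_zero, seqMonomial]
    refine Finset.prod_eq_one fun j hj => ?_
    have hj : j ≠ i := fun h => hi (h ▸ hj)
    simp [Function.update_of_ne hj]

theorem torusCoe_mul_mulSingle (w : ℕ → Circle) (i : ℕ) (v : Circle) :
    torusCoe (w * Pi.mulSingle i v)
      = fun j => torusCoe w j * (Function.update 1 i (v : ℂ) : ℕ → ℂ) j := by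
  funext j
  by_cases hj : j = i
  · subst hj; simp [torusCoe]
  · simp [torusCoe, hj]

theorem measurable_mulSingle (i : ℕ) :
    Measurable fun v : Circle => (Pi.mulSingle i v : ℕ → Circle) :=
  (continuous_mulSingle i).measurable

/-- The analytic polynomial `∑_{α ∈ F} a_α y^α`. -/
def seqPoly (F : Finset (ℕ →₀ ℕ)) (a : (ℕ →₀ ℕ) → ℂ) (y : ℕ → ℂ) : ℂ :=
  ∑ α ∈ F, a α * seqMonomial α y

theorem continuous_seqPoly (F : Finset (ℕ →₀ ℕ)) (a : (ℕ →₀ ℕ) → ℂ) :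
    Continuous (seqPoly F a) := by
  have := continuous_seqMonomial
  unfold seqPoly; fun_prop

theorem continuous_seqPoly_torusCoe (F : Finset (ℕ →₀ ℕ)) (a : (ℕ →₀ ℕ) → ℂ) :
    Continuous fun w => seqPoly F a (torusCoe w) :=
  (continuous_seqPoly F a).comp continuous_torusCoe

/-- Rotating the coordinate `i` by `v` turns the polynomial into a one-variable polynomial in `v`
whose `k`-th coefficient collects the monomials of degree `k` in that coordinate. The one-variable
bound is applied for each `w` and integrated; invariance turns the double integral back into the
`L_1` norm. -/
theorem sum_integral_fiber_le {s x : ℝ} (hs : s < 1) (h0 : 0 ≤ x) (hx : x ≤ s)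
    (F : Finset (ℕ →₀ ℕ)) (a : (ℕ →₀ ℕ) → ℂ) (i N : ℕ) (hN : ∀ α ∈ F, α i ≤ N) :
    ∑ k ∈ Finset.range (N + 1), x ^ k *
        ∫ w, ‖seqPoly (F.filter fun α => α i = k) a (torusCoe w)‖ ∂torusMeasure
      ≤ Real.exp (2 / (1 - s) ^ 2 * x ^ 2) *
        ∫ w, ‖seqPoly F a (torusCoe w)‖ ∂torusMeasure := by
  set b : ℕ → (ℕ → Circle) → ℂ := fun k w =>
    seqPoly (F.filter fun α => α i = k) a (torusCoe w) with hb
  have hbc : ∀ k, Continuous (b k) := fun k => continuous_seqPoly_torusCoe _ a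
  have hP : ∀ (w : ℕ → Circle) (v : Circle), seqPoly F a (torusCoe (w * Pi.mulSingle i v))
      = ∑ k ∈ Finset.range (N + 1), b k w * (v : ℂ) ^ k := fun w v => by
    have hmaps : ∀ α ∈ F, α i ∈ Finset.range (N + 1) := fun α hα =>
      Finset.mem_range.2 (Nat.lt_succ_of_le (hN α hα))
    rw [seqPoly, ← Finset.sum_fiberwise_of_maps_to hmaps]
    refine Finset.sum_congr rfl fun k _ => ?_
    simp only [hb]
    rw [seqPoly, Finset.sum_mul]
    refine Finset.sum_congr rfl fun α hα => ?_
    rw [torusCoe_mul_mulSingle, seqMonomial_mul, seqMonomial_update_one,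
      (Finset.mem_filter.1 hα).2, mul_assoc]
  have hPint := integrable_of_continuous (continuous_seqPoly_torusCoe F a).norm
  have hmp := measurePreserving_mul (ν := circleMeasure) (measurable_mulSingle i)
  have hint : Integrable (fun q : (ℕ → Circle) × Circle =>
      ‖seqPoly F a (torusCoe (q.1 * Pi.mulSingle i q.2))‖) (torusMeasure.prod circleMeasure) :=
    hmp.integrable_comp_of_integrable hPint
  rw [← integral_integral_mul (ν := circleMeasure) hPint (measurable_mulSingle i),
    ← integral_const_mul]
  simp only [← integral_const_mul]
  rw [← integral_finsetSum _ fun k _ => ((integrable_of_continuous (hbc k).norm).const_mul _)]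
  refine integral_mono
    (integrable_finsetSum _ fun k _ => ((integrable_of_continuous (hbc k).norm).const_mul _))
    ?_ fun w => ?_
  · simp only [integral_const_mul]
    exact hint.integral_prod_left.const_mul _
  · have h := sum_coeff_le_integral hs h0 hx (fun k => b k w) N
    simp only [← hP] at h
    simpa only [integral_const_mul] using h

/-- A weighted `ℓ₁` bound for the coefficients of an analytic polynomial in several variables by
its `L₁` norm, with a constant depending only on the `ℓ₂` norm of the weights. -/
theorem sum_prod_coeff_le_integral {s : ℝ} (hs : s < 1) {x : ℕ → ℝ} (h0 : ∀ i, 0 ≤ x i)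
    (hx : ∀ i, x i ≤ s) (a : (ℕ →₀ ℕ) → ℂ) (S : Finset ℕ) :
    ∀ F : Finset (ℕ →₀ ℕ), (∀ α ∈ F, ∀ β ∈ F, (∀ i ∈ S, α i = β i) → α = β) →
    ∑ α ∈ F, (∏ i ∈ S, x i ^ α i) * ‖a α‖ ≤ Real.exp (2 / (1 - s) ^ 2 * ∑ i ∈ S, x i ^ 2) *
      ∫ w, ‖seqPoly F a (torusCoe w)‖ ∂torusMeasure := by
  induction S using Finset.induction_on with
  | empty =>
    intro F hF
    -- The separation hypothesis on `F` is made for this case: with no coordinate left, `F` has at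
    -- most one index, and the `L_1` norm of a single term is the modulus of its coefficient.
    rcases F.eq_empty_or_nonempty with rfl | ⟨β, hβ⟩
    · simp [seqPoly]
    · obtain rfl : F = {β} := Finset.eq_singleton_iff_unique_mem.2
        ⟨hβ, fun α hα => hF α hα β hβ (by simp)⟩
      simp [seqPoly, norm_seqMonomial_torusCoe]
  | insert i S hi ih =>
    intro F hF
    set N := F.sup fun α => α i
    have hN : ∀ α ∈ F, α i ≤ N := fun α hα => Finset.le_sup (f := fun α : ℕ →₀ ℕ => α i) hα
    have hmaps : ∀ α ∈ F, α i ∈ Finset.range (N + 1) := fun α hα =>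
      Finset.mem_range.2 (Nat.lt_succ_of_le (hN α hα))
    rw [← Finset.sum_fiberwise_of_maps_to hmaps, Finset.sum_insert hi, mul_add, Real.exp_add,
      mul_comm (Real.exp _), mul_assoc]
    refine le_trans ?_ (mul_le_mul_of_nonneg_left
      (sum_integral_fiber_le hs (h0 i) (hx i) F a i N hN) (Real.exp_pos _).le)
    rw [Finset.mul_sum]
    refine Finset.sum_le_sum fun k _ => ?_
    have h1 := ih (F.filter fun α => α i = k) fun α hα β hβ hαβ => by
      rw [Finset.mem_filter] at hα hβ
      refine hF α hα.1 β hβ.1 fun j hj => ?_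
      rcases Finset.mem_insert.1 hj with rfl | hj
      · rw [hα.2, hβ.2]
      · exact hαβ j hj
    have h2 : ∑ α ∈ F with α i = k, (∏ j ∈ insert i S, x j ^ α j) * ‖a α‖
        = x i ^ k * ∑ α ∈ F with α i = k, (∏ j ∈ S, x j ^ α j) * ‖a α‖ := by
      rw [Finset.mul_sum]
      refine Finset.sum_congr rfl fun α hα => ?_
      rw [Finset.prod_insert hi, (Finset.mem_filter.1 hα).2, mul_assoc]
    rw [h2]
    refine (mul_le_mul_of_nonneg_left h1 (pow_nonneg (h0 i) k)).trans (le_of_eq ?_)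
    ring

/-- Taking for `S` the union of the supports makes the separation hypothesis automatic. Enlarging
the sum over `S` to the full series removes `F` from the constant. -/
theorem sum_norm_seqMonomial_le {s : ℝ} (hs : s < 1) {y : ℕ → ℂ} (hy : ∀ i, ‖y i‖ ≤ s)
    (hy2 : Summable fun i => ‖y i‖ ^ 2) (F : Finset (ℕ →₀ ℕ)) (a : (ℕ →₀ ℕ) → ℂ) :
    ∑ α ∈ F, ‖a α * seqMonomial α y‖ ≤ Real.exp (2 / (1 - s) ^ 2 * ∑' i, ‖y i‖ ^ 2) *
      ∫ w, ‖seqPoly F a (torusCoe w)‖ ∂torusMeasure := by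
  have hsub : ∀ α ∈ F, α.support ⊆ F.sup Finsupp.support := fun α hα => Finset.le_sup hα
  have h := sum_prod_coeff_le_integral hs (fun i => norm_nonneg (y i)) hy a
    (F.sup Finsupp.support) F fun α hα β hβ hαβ => by
      ext i
      by_cases hi : i ∈ F.sup Finsupp.support
      · exact hαβ i hi
      · rw [Finsupp.notMem_support_iff.1 fun h => hi (hsub α hα h),
          Finsupp.notMem_support_iff.1 fun h => hi (hsub β hβ h)]
  have h2 : ∑ α ∈ F, ‖a α * seqMonomial α y‖
      = ∑ α ∈ F, (∏ i ∈ F.sup Finsupp.support, ‖y i‖ ^ α i) * ‖a α‖ :=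
    Finset.sum_congr rfl fun α hα => by
      rw [seqMonomial_eq_prod (hsub α hα), norm_mul, norm_prod, mul_comm]
      simp
  rw [h2]
  refine h.trans (mul_le_mul_of_nonneg_right ?_ (integral_nonneg fun w => norm_nonneg _))
  refine Real.exp_le_exp.2 (mul_le_mul_of_nonneg_left ?_ (by positivity))
  exact hy2.sum_le_tsum _ fun i _ => by positivity

/-! ### Characters, trigonometric polynomials and uniqueness of Fourier coefficients -/

theorem torusMonomial_mul (α : ℕ →₀ ℤ) (w v : ℕ → Circle) :
    torusMonomial α (w * v) = torusMonomial α w * torusMonomial α v := by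
  simp [torusMonomial, Finsupp.prod, mul_zpow, Finset.prod_mul_distrib]

theorem torusMonomial_zero (w : ℕ → Circle) : torusMonomial 0 w = 1 := by
  simp [torusMonomial]

theorem torusMonomial_add (α β : ℕ →₀ ℤ) (w : ℕ → Circle) :
    torusMonomial (α + β) w = torusMonomial α w * torusMonomial β w :=
  Finsupp.prod_add_index' (by simp) fun _ _ _ => zpow_add _ _ _

theorem torusMonomial_neg (α : ℕ →₀ ℤ) (w : ℕ → Circle) :
    torusMonomial (-α) w = (torusMonomial α w)⁻¹ := by
  rw [eq_inv_iff_mul_eq_one, ← torusMonomial_add, neg_add_cancel, torusMonomial_zero]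

theorem torusMonomial_mulSingle (α : ℕ →₀ ℤ) (i : ℕ) (v : Circle) :
    torusMonomial α (Pi.mulSingle i v) = v ^ α i := by
  by_cases hi : i ∈ α.support
  · rw [torusMonomial, Finsupp.prod, Finset.prod_eq_single_of_mem i hi]
    · simp
    · intro j _ hj
      simp [hj]
  · have hi0 : α i = 0 := by simpa using hi
    rw [hi0, zpow_zero, torusMonomial]
    refine Finset.prod_eq_one fun j hj => ?_
    have hj : j ≠ i := fun h => hi (h ▸ hj)
    simp [hj]

theorem integral_torusMonomial {α : ℕ →₀ ℤ} (hα : α ≠ 0) :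
    ∫ w, (torusMonomial α w : ℂ) ∂torusMeasure = 0 := by
  obtain ⟨i, hi⟩ := Finsupp.ne_iff.1 hα
  rw [← integral_integral_mul (ν := circleMeasure)
    (integrable_of_continuous (continuous_torusMonomial α)) (measurable_mulSingle i)]
  simp only [torusMonomial_mul, torusMonomial_mulSingle, Circle.coe_mul, integral_const_mul,
    integral_zpow_circle hi, mul_zero, integral_zero]

theorem fourierCoeff_torusMonomial (α β : ℕ →₀ ℤ) :
    fourierCoeff (fun w => (torusMonomial α w : ℂ)) β = if α = β then 1 else 0 := by
  simp only [fourierCoeff, ← Circle.coe_mul, ← torusMonomial_add]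
  split_ifs with h
  · simp [h, torusMonomial_zero]
  · exact integral_torusMonomial fun h' => h (by rwa [← sub_eq_add_neg, sub_eq_zero] at h')

/-- The character `w ↦ w^α` as a continuous map. -/
def torusChar (α : ℕ →₀ ℤ) : C(ℕ → Circle, ℂ) :=
  ⟨fun w => (torusMonomial α w : ℂ), continuous_torusMonomial α⟩

theorem torusChar_apply (α : ℕ →₀ ℤ) (w : ℕ → Circle) : torusChar α w = torusMonomial α w := rfl

theorem torusChar_add (α β : ℕ →₀ ℤ) : torusChar (α + β) = torusChar α * torusChar β := by
  ext w
  simp [torusChar_apply, torusMonomial_add]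

theorem torusChar_zero : torusChar 0 = 1 := by
  ext w
  simp [torusChar_apply, torusMonomial_zero]

theorem star_torusChar (α : ℕ →₀ ℤ) : star (torusChar α) = torusChar (-α) := by
  ext w
  rw [ContinuousMap.star_apply, torusChar_apply, torusChar_apply, torusMonomial_neg,
    Circle.coe_inv_eq_conj]
  rfl

/-- The star subalgebra of trigonometric polynomials on the infinite torus. -/
def trigSubalgebra : StarSubalgebra ℂ C(ℕ → Circle, ℂ) where
  toSubalgebra := Algebra.adjoin ℂ (Set.range torusChar)
  star_mem' := by
    change Algebra.adjoin ℂ (Set.range torusChar) ≤ star (Algebra.adjoin ℂ (Set.range torusChar))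
    refine Algebra.adjoin_le ?_
    rintro _ ⟨α, rfl⟩
    exact Algebra.subset_adjoin ⟨-α, (star_torusChar α).symm⟩

theorem trigSubalgebra_coe :
    Subalgebra.toSubmodule trigSubalgebra.toSubalgebra
      = Submodule.span ℂ (Set.range torusChar) := by
  refine Algebra.adjoin_eq_span_of_subset _ (Set.Subset.trans ?_ Submodule.subset_span)
  intro x hx
  refine Submonoid.closure_induction (fun _ => id) ⟨0, torusChar_zero⟩ ?_ hx
  rintro _ _ _ _ ⟨α, rfl⟩ ⟨β, rfl⟩
  exact ⟨α + β, torusChar_add α β⟩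

theorem trigSubalgebra_separatesPoints : trigSubalgebra.SeparatesPoints := by
  intro w v hwv
  obtain ⟨i, hi⟩ := Function.ne_iff.1 hwv
  refine ⟨_, ⟨torusChar (Finsupp.single i 1), Algebra.subset_adjoin ⟨_, rfl⟩, rfl⟩, ?_⟩
  intro h
  refine hi (Circle.ext ?_)
  simpa [torusChar_apply, torusMonomial] using h

/-- Trigonometric polynomials are uniformly dense in the continuous functions. -/
theorem span_torusChar_closure_eq_top :
    (Submodule.span ℂ (Set.range torusChar)).topologicalClosure = ⊤ := by
  rw [← trigSubalgebra_coe]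
  exact congrArg (Subalgebra.toSubmodule <| StarSubalgebra.toSubalgebra ·)
    (ContinuousMap.starSubalgebra_topologicalClosure_eq_top_of_separatesPoints trigSubalgebra
      trigSubalgebra_separatesPoints)

theorem exists_trig_near (b : C(ℕ → Circle, ℂ)) {δ : ℝ} (hδ : 0 < δ) :
    ∃ c : (ℕ →₀ ℤ) →₀ ℂ, ∀ w, ‖b w - c.sum fun α a => a * (torusMonomial α w : ℂ)‖ ≤ δ := by
  have hb : b ∈ closure (Submodule.span ℂ (Set.range torusChar) : Set C(ℕ → Circle, ℂ)) := by
    have : b ∈ (Submodule.span ℂ (Set.range torusChar)).topologicalClosure := by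
      rw [span_torusChar_closure_eq_top]; trivial
    exact this
  obtain ⟨q, hq, hbq⟩ := Metric.mem_closure_iff.1 hb δ hδ
  obtain ⟨c, rfl⟩ := Finsupp.mem_span_range_iff_exists_finsupp.1 hq
  refine ⟨c, fun w => ?_⟩
  have h := (ContinuousMap.norm_coe_le_norm (b - c.sum fun i a => a • torusChar i) w).trans
    (dist_eq_norm b _ ▸ hbq).le
  simpa [Finsupp.sum, torusChar_apply] using h

/-- A continuous function on the infinite torus with vanishing Fourier coefficients is zero. -/
theorem eq_zero_of_fourierCoeff_eq_zero {u : (ℕ → Circle) → ℂ} (hu : Continuous u)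
    (h : ∀ α, fourierCoeff u α = 0) : u = 0 := by
  have hint : ∀ {v : (ℕ → Circle) → ℂ}, Continuous v → Integrable v torusMeasure := fun hv =>
    integrable_of_continuous hv
  have hmono := continuous_torusMonomial
  set I := ∫ w, ‖u w‖ ∂torusMeasure
  have hI0 : 0 ≤ I := integral_nonneg fun _ => norm_nonneg _
  -- The conjugate of `u` is uniformly approximated by trigonometric polynomials, and `u` integrates
  -- to zero against each of them. The tolerance is divided by `I + 1` because `I` may vanish.
  have hsq : ∫ w, u w * starRingEnd ℂ (u w) ∂torusMeasure = 0 := by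
    refine norm_le_zero_iff.1 (le_of_forall_pos_le_add fun ε hε => ?_)
    obtain ⟨c, hc⟩ := exists_trig_near ⟨fun w => starRingEnd ℂ (u w), by fun_prop⟩
      (div_pos hε (show 0 < I + 1 by positivity))
    have hq : Continuous fun w => c.sum fun α a => a * (torusMonomial α w : ℂ) := by
      unfold Finsupp.sum; fun_prop
    have h0 : ∫ w, u w * (c.sum fun α a => a * (torusMonomial α w : ℂ)) ∂torusMeasure = 0 := by
      simp only [Finsupp.sum, Finset.mul_sum]
      rw [integral_finsetSum _ fun α _ => hint (by fun_prop)]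
      refine Finset.sum_eq_zero fun α _ => ?_
      have h1 := h (-α)
      rw [fourierCoeff, neg_neg] at h1
      have : ∀ w, u w * (c α * (torusMonomial α w : ℂ))
          = c α * (u w * (torusMonomial α w : ℂ)) := fun w => by ring
      simp only [this, integral_const_mul, h1, mul_zero]
    have h2 : ∫ w, u w * starRingEnd ℂ (u w) ∂torusMeasure = ∫ w, u w * (starRingEnd ℂ (u w) -
        c.sum fun α a => a * (torusMonomial α w : ℂ)) ∂torusMeasure := by
      simp only [mul_sub]
      rw [integral_sub (hint (by fun_prop)) (hint (by fun_prop)), h0, sub_zero]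
    rw [h2, zero_add]
    refine (norm_integral_le_of_norm_le (g := fun w => ‖u w‖ * (ε / (I + 1)))
      ((integrable_of_continuous hu.norm).mul_const _)
      (Filter.Eventually.of_forall fun w => ?_)).trans ?_
    · rw [norm_mul]
      exact mul_le_mul_of_nonneg_left (hc w) (norm_nonneg _)
    · rw [integral_mul_const, mul_div_assoc', div_le_iff₀ (by positivity)]
      change I * ε ≤ _
      nlinarith
  have hsq2 : ∫ w, ‖u w‖ ^ 2 ∂torusMeasure = 0 := by
    have : ∀ w, u w * starRingEnd ℂ (u w) = ((‖u w‖ ^ 2 : ℝ) : ℂ) := fun w => by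
      rw [Complex.mul_conj, Complex.normSq_eq_norm_sq]
    simp only [this] at hsq
    rw [integral_complex_ofReal] at hsq
    exact_mod_cast hsq
  by_contra hne
  obtain ⟨w, hw⟩ := Function.ne_iff.1 hne
  have hpos := (hu.norm.pow 2).integral_pos_of_hasCompactSupport_nonneg_nonzero
    (μ := torusMeasure) (x := w) (HasCompactSupport.of_compactSpace _) (fun _ => sq_nonneg _)
    (by simpa using hw)
  exact hpos.ne' hsq2

/-! ### Fourier coefficients on `L_p` and density of analytic polynomials -/

theorem memLp_of_continuous (p : ℝ≥0∞) {u : (ℕ → Circle) → ℂ} (hu : Continuous u) :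
    MemLp u p torusMeasure := by
  obtain ⟨C, hC⟩ := isCompact_univ.exists_bound_of_continuousOn hu.continuousOn
  exact MemLp.of_bound hu.aestronglyMeasurable C
    (Filter.Eventually.of_forall fun w => hC w (Set.mem_univ w))

theorem fourierCoeff_congr {f g : (ℕ → Circle) → ℂ} (h : f =ᵐ[torusMeasure] g) (α : ℕ →₀ ℤ) :
    fourierCoeff f α = fourierCoeff g α :=
  integral_congr_ae (h.mono fun w hw => by simp only [hw])

theorem integral_norm_le_norm {p : ℝ≥0∞} [hp : Fact (1 ≤ p)] (f : Lp ℂ p torusMeasure) :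
    ∫ w, ‖f w‖ ∂torusMeasure ≤ ‖f‖ := by
  rw [integral_norm_eq_lintegral_enorm (Lp.aestronglyMeasurable f),
    ← eLpNorm_one_eq_lintegral_enorm, Lp.norm_def]
  exact ENNReal.toReal_mono (Lp.eLpNorm_ne_top f)
    (eLpNorm_le_eLpNorm_of_exponent_le hp.out (Lp.aestronglyMeasurable f))

theorem norm_fourierCoeff_le {p : ℝ≥0∞} [Fact (1 ≤ p)] (f : Lp ℂ p torusMeasure) (α : ℕ →₀ ℤ) :
    ‖fourierCoeff f α‖ ≤ ‖f‖ := by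
  refine (norm_integral_le_integral_norm _).trans (le_trans (le_of_eq ?_) (integral_norm_le_norm f))
  simp [Circle.norm_coe]

/-- The Fourier coefficient as a continuous linear functional on `L_p`. -/
def fourierCLM (p : ℝ≥0∞) [Fact (1 ≤ p)] (α : ℕ →₀ ℤ) : Lp ℂ p torusMeasure →L[ℂ] ℂ :=
  LinearMap.mkContinuous
    { toFun := fun f => fourierCoeff f α
      map_add' := fun f g => by
        rw [fourierCoeff_congr (Lp.coeFn_add f g)]
        simp only [fourierCoeff, Pi.add_apply, add_mul]
        exact integral_add (integrable_mul_torusMonomial f _) (integrable_mul_torusMonomial g _)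
      map_smul' := fun c f => by
        rw [fourierCoeff_congr (Lp.coeFn_smul c f)]
        simp only [fourierCoeff, Pi.smul_apply, smul_eq_mul, mul_assoc, integral_const_mul,
          RingHom.id_apply] }
    1 fun f => by simpa using norm_fourierCoeff_le f α

/-- The character `w ↦ w^α` as an element of `L_p`. -/
def torusCharLp (p : ℝ≥0∞) (α : ℕ →₀ ℤ) : Lp ℂ p torusMeasure :=
  (memLp_of_continuous p (continuous_torusMonomial α)).toLp _

theorem coeFn_torusCharLp (p : ℝ≥0∞) (α : ℕ →₀ ℤ) :
    torusCharLp p α =ᵐ[torusMeasure] fun w => (torusMonomial α w : ℂ) :=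
  MemLp.coeFn_toLp _

theorem fourierCoeff_torusCharLp (p : ℝ≥0∞) (α β : ℕ →₀ ℤ) :
    fourierCoeff (torusCharLp p α) β = if α = β then 1 else 0 := by
  rw [fourierCoeff_congr (coeFn_torusCharLp p α), fourierCoeff_torusMonomial]

/-- A single member of an approximate identity. By compactness the translates of `c` depend
continuously on `v` in the uniform norm, so those within `ε` of `c` come from a neighbourhood `U` of
`1`; a normalized Urysohn function supported in `U` is the kernel. -/
theorem exists_bump (c : C(ℕ → Circle, ℂ)) {ε : ℝ} (hε : 0 < ε) :
    ∃ b : (ℕ → Circle) → ℝ, Continuous b ∧ (∀ v, 0 ≤ b v) ∧ ∫ v, b v ∂torusMeasure = 1 ∧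
      ∀ v, b v ≠ 0 → ∀ w, ‖c w - c (w * v)‖ ≤ ε := by
  let T : C((ℕ → Circle), C((ℕ → Circle), ℂ)) :=
    ContinuousMap.curry ⟨fun q : (ℕ → Circle) × (ℕ → Circle) => c (q.2 * q.1), by fun_prop⟩
  have hT : ∀ v w, T v w = c (w * v) := fun _ _ => rfl
  let U : Set (ℕ → Circle) := {v | dist (T v) (T 1) < ε}
  have hU : IsOpen U := isOpen_lt (by fun_prop) continuous_const
  have h1U : (1 : ℕ → Circle) ∈ U := by simpa [U] using hε
  obtain ⟨b, hb0, hb1, hb⟩ := exists_continuous_zero_one_of_isClosed hU.isClosed_compl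
    (isClosed_singleton (x := (1 : ℕ → Circle))) (by simpa using h1U)
  have hpos := (map_continuous b).integral_pos_of_hasCompactSupport_nonneg_nonzero
    (μ := torusMeasure) (x := 1) (HasCompactSupport.of_compactSpace _) (fun v => (hb v).1)
    (by rw [hb1 rfl]; exact one_ne_zero)
  refine ⟨fun v => (∫ v, b v ∂torusMeasure)⁻¹ * b v, by fun_prop,
    fun v => mul_nonneg (inv_nonneg.2 hpos.le) (hb v).1, ?_, fun v hv w => ?_⟩
  · rw [integral_const_mul, inv_mul_cancel₀ hpos.ne']
  · have hvU : v ∈ U := by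
      by_contra h
      exact hv (by simp [hb0 h])
    have h2 := (ContinuousMap.dist_apply_le_dist (f := T v) (g := T 1) w).trans hvU.le
    rw [hT, hT, mul_one, dist_comm, dist_eq_norm] at h2
    exact h2

/-- Convolution with a probability density is an average of translates for the measure of density
`b`. -/
theorem eLpNorm_convolution_le {p : ℝ≥0∞} (hp1 : 1 ≤ p) (hp : p ≠ ∞) {b : (ℕ → Circle) → ℝ}
    (hb : Continuous b) (hb0 : ∀ v, 0 ≤ b v) (hb1 : ∫ v, b v ∂torusMeasure = 1)
    {f : (ℕ → Circle) → ℂ} (hf : StronglyMeasurable f) :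
    eLpNorm (fun w => ∫ v, f (w * v) * (b v : ℂ) ∂torusMeasure) p torusMeasure
      ≤ eLpNorm f p torusMeasure := by
  let ν := torusMeasure.withDensity fun v => ENNReal.ofReal (b v)
  have hm : Measurable fun v => ENNReal.ofReal (b v) := hb.measurable.ennreal_ofReal
  have : IsProbabilityMeasure ν := ⟨by
    rw [withDensity_apply _ MeasurableSet.univ, Measure.restrict_univ,
      ← ofReal_integral_eq_lintegral_ofReal (integrable_of_continuous hb)
        (Filter.Eventually.of_forall hb0), hb1, ENNReal.ofReal_one]⟩
  have h := eLpNorm_average_le (ν := ν) (θ := id) hp1 hp hf measurable_id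
  refine le_trans (le_of_eq ?_) h
  congr 1
  funext w
  rw [integral_withDensity_eq_integral_toReal_smul hm (by simp)]
  refine integral_congr_ae (Filter.Eventually.of_forall fun v => ?_)
  simp [ENNReal.toReal_ofReal (hb0 v), mul_comm]

theorem integrable_translate_mul {f : (ℕ → Circle) → ℂ} (hf : Integrable f torusMeasure)
    {b : (ℕ → Circle) → ℂ} (hb : Continuous b) (w : ℕ → Circle) :
    Integrable (fun v => f (w * v) * b v) torusMeasure := by
  obtain ⟨C, hC⟩ := isCompact_univ.exists_bound_of_continuousOn hb.continuousOn
  exact (hf.comp_mul_left w).mul_bdd (c := C) hb.aestronglyMeasurable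
    (Filter.Eventually.of_forall fun v => hC v (Set.mem_univ v))

theorem integral_translate_mul_torusMonomial (f : (ℕ → Circle) → ℂ) (α : ℕ →₀ ℤ)
    (w : ℕ → Circle) :
    ∫ v, f (w * v) * (torusMonomial α v : ℂ) ∂torusMeasure
      = fourierCoeff f (-α) * (torusMonomial (-α) w : ℂ) := by
  have h : ∀ v, f (w * v) * (torusMonomial α v : ℂ)
      = (f (w * v) * (torusMonomial α (w * v) : ℂ)) * (torusMonomial (-α) w : ℂ) := fun v => by
    rw [torusMonomial_mul, torusMonomial_neg, mul_assoc, ← Circle.coe_mul]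
    congr 2
    rw [mul_comm (torusMonomial α w), mul_inv_cancel_right]
  simp only [h]
  rw [integral_mul_const, fourierCoeff, neg_neg,
    integral_mul_left_eq_self (fun v => f v * (torusMonomial α v : ℂ)) w]

theorem eLpNorm_le_ofReal {p : ℝ≥0∞} {u : (ℕ → Circle) → ℂ} {C : ℝ} (h : ∀ w, ‖u w‖ ≤ C) :
    eLpNorm u p torusMeasure ≤ ENNReal.ofReal C := by
  refine (eLpNorm_le_of_ae_bound (Filter.Eventually.of_forall h)).trans ?_
  simp

/-- Every function in `L_p` is approximated by trigonometric polynomials whose coefficients are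
multiples of its Fourier coefficients. -/
theorem exists_multiplier_near {p : ℝ≥0∞} [hp1 : Fact (1 ≤ p)] (hp : p ≠ ∞)
    (f : Lp ℂ p torusMeasure) {ε : ℝ} (hε : 0 < ε) :
    ∃ k : (ℕ →₀ ℤ) →₀ ℂ, eLpNorm (fun w => f w - ∑ γ ∈ k.support,
      k γ * (fourierCoeff f (-γ) * (torusMonomial (-γ) w : ℂ))) p torusMeasure
        ≤ ENNReal.ofReal ε := by
  -- Four errors of `ε / 4`: from `f` to a continuous `c`, from `c` to its convolution `B c`, from
  -- `B c` to `B f` by contraction, and from `B f` to the convolution of `f` with a trigonometric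
  -- kernel `k` close to `b`. Convolving `f` with a kernel of uniform size `δ` costs `δ I`, whence
  -- the tolerance chosen for `k`.
  have hε4 : 0 < ε / 4 := by positivity
  obtain ⟨c, hc, hcm⟩ := (Lp.memLp f).exists_boundedContinuous_eLpNorm_sub_le hp
    (ENNReal.ofReal_pos.2 hε4).ne'
  obtain ⟨b, hbc, hb0, hb1, hb⟩ := exists_bump c.toContinuousMap hε4
  have hfi : Integrable f torusMeasure := (Lp.memLp f).integrable hp1.out
  have hci : Integrable c torusMeasure := hcm.integrable hp1.out
  set I := ∫ w, ‖f w‖ ∂torusMeasure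
  have hI0 : 0 ≤ I := integral_nonneg fun _ => norm_nonneg _
  obtain ⟨k, hk⟩ := exists_trig_near ⟨fun v => (b v : ℂ), by fun_prop⟩
    (div_pos hε4 (show 0 < I + 1 by positivity))
  have hbC : Continuous fun v => (b v : ℂ) := by fun_prop
  have hmono := continuous_torusMonomial
  have hKc : Continuous fun v => k.sum fun α a => a * (torusMonomial α v : ℂ) := by
    unfold Finsupp.sum; fun_prop
  have hK : ∀ w, ∑ γ ∈ k.support, k γ * (fourierCoeff f (-γ) * (torusMonomial (-γ) w : ℂ))
      = ∫ v, f (w * v) * (k.sum fun α a => a * (torusMonomial α v : ℂ)) ∂torusMeasure := fun w => by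
    simp only [Finsupp.sum, Finset.mul_sum]
    rw [integral_finsetSum _ fun α _ => integrable_translate_mul hfi (by fun_prop) w]
    refine Finset.sum_congr rfl fun γ _ => ?_
    rw [← integral_translate_mul_torusMonomial, ← integral_const_mul]
    refine integral_congr_ae (Filter.Eventually.of_forall fun v => ?_)
    ring
  set B : ((ℕ → Circle) → ℂ) → (ℕ → Circle) → ℂ := fun h w =>
    ∫ v, h (w * v) * (b v : ℂ) ∂torusMeasure with hB
  have hfs := Lp.stronglyMeasurable f
  have hBm : ∀ {h : (ℕ → Circle) → ℂ}, StronglyMeasurable h →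
      AEStronglyMeasurable (B h) torusMeasure := fun hh => by
    refine (StronglyMeasurable.integral_prod_right (f := fun w v => _) ?_).aestronglyMeasurable
    exact (hh.comp_measurable measurable_mul).mul
      (hbC.comp continuous_snd).measurable.stronglyMeasurable
  have hcs : StronglyMeasurable (fun w => c w) := c.continuous.stronglyMeasurable
  have e1 : eLpNorm (fun w => c w - B c w) p torusMeasure ≤ ENNReal.ofReal (ε / 4) := by
    refine eLpNorm_le_ofReal fun w => ?_
    have h1 : c w - B c w = ∫ v, (c w - c (w * v)) * (b v : ℂ) ∂torusMeasure := by
      simp only [sub_mul]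
      rw [integral_sub ((integrable_of_continuous hbC).const_mul _)
        (integrable_translate_mul hci hbC w), integral_const_mul, integral_complex_ofReal, hb1]
      simp [hB]
    rw [h1]
    refine (norm_integral_le_of_norm_le (g := fun v => ε / 4 * b v)
      ((integrable_of_continuous hbc).const_mul _)
      (Filter.Eventually.of_forall fun v => ?_)).trans ?_
    · rw [norm_mul, Complex.norm_real, Real.norm_of_nonneg (hb0 v)]
      by_cases hv : b v = 0
      · simp [hv]
      · exact mul_le_mul_of_nonneg_right (hb v hv w) (hb0 v)
    · rw [integral_const_mul, hb1, mul_one]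
  have e2 : eLpNorm (fun w => B c w - B f w) p torusMeasure ≤ ENNReal.ofReal (ε / 4) := by
    have h1 : (fun w => B c w - B f w) = fun w =>
        ∫ v, (c (w * v) - f (w * v)) * (b v : ℂ) ∂torusMeasure := by
      funext w
      simp only [sub_mul]
      rw [integral_sub (integrable_translate_mul hci hbC w) (integrable_translate_mul hfi hbC w)]
    rw [h1]
    refine (eLpNorm_convolution_le hp1.out hp hbc hb0 hb1 (hcs.sub hfs)).trans ?_
    rw [← eLpNorm_neg]
    refine le_trans (le_of_eq ?_) hc
    congr 1
    funext w
    simp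
  have e3 : eLpNorm (fun w => B f w - ∑ γ ∈ k.support,
      k γ * (fourierCoeff f (-γ) * (torusMonomial (-γ) w : ℂ))) p torusMeasure
        ≤ ENNReal.ofReal (ε / 4) := by
    refine eLpNorm_le_ofReal fun w => ?_
    rw [hK]
    simp only [hB]
    rw [← integral_sub (integrable_translate_mul hfi hbC w) (integrable_translate_mul hfi hKc w)]
    refine (norm_integral_le_of_norm_le (g := fun v => ‖f (w * v)‖ * (ε / 4 / (I + 1)))
      ((hfi.comp_mul_left w).norm.mul_const _)
      (Filter.Eventually.of_forall fun v => ?_)).trans ?_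
    · rw [← mul_sub, norm_mul]
      exact mul_le_mul_of_nonneg_left (hk v) (norm_nonneg _)
    · rw [integral_mul_const, integral_mul_left_eq_self (fun v => ‖f v‖) w, mul_div_assoc',
        div_le_iff₀ (by positivity)]
      change I * (ε / 4) ≤ _
      nlinarith
  refine ⟨k, ?_⟩
  have hq : AEStronglyMeasurable (fun w => ∑ γ ∈ k.support,
      k γ * (fourierCoeff f (-γ) * (torusMonomial (-γ) w : ℂ))) torusMeasure :=
    Continuous.aestronglyMeasurable (by fun_prop)
  have hsplit : (fun w => f w - ∑ γ ∈ k.support,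
      k γ * (fourierCoeff f (-γ) * (torusMonomial (-γ) w : ℂ)))
      = (fun w => f w - c w) + ((fun w => c w - B c w) + ((fun w => B c w - B f w) +
        fun w => B f w - ∑ γ ∈ k.support,
          k γ * (fourierCoeff f (-γ) * (torusMonomial (-γ) w : ℂ)))) := by
    funext w
    simp
  have m1 := hfs.aestronglyMeasurable (μ := torusMeasure)
  have m2 := hcs.aestronglyMeasurable (μ := torusMeasure)
  rw [hsplit]
  refine (eLpNorm_add_le (m1.sub m2) ((m2.sub (hBm hcs)).add (((hBm hcs).sub (hBm hfs)).add
    ((hBm hfs).sub hq))) hp1.out).trans ?_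
  refine (add_le_add hc ((eLpNorm_add_le (m2.sub (hBm hcs)) (((hBm hcs).sub (hBm hfs)).add
    ((hBm hfs).sub hq)) hp1.out).trans (add_le_add e1 ((eLpNorm_add_le ((hBm hcs).sub (hBm hfs))
    ((hBm hfs).sub hq) hp1.out).trans (add_le_add e2 e3))))).trans (le_of_eq ?_)
  rw [← ENNReal.ofReal_add (by positivity) (by positivity),
    ← ENNReal.ofReal_add (by positivity) (by positivity),
    ← ENNReal.ofReal_add (by positivity) (by positivity)]
  congr 1
  ring

theorem mem_hpTorus {p : ℝ≥0∞} [Fact (1 ≤ p)] {f : Lp ℂ p torusMeasure} :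
    f ∈ HpTorus p ↔ ∀ α : ℕ →₀ ℤ, (∃ i, α i < 0) → fourierCoeff f α = 0 := Iff.rfl

theorem isClosed_hpTorus (p : ℝ≥0∞) [Fact (1 ≤ p)] :
    IsClosed (HpTorus p : Set (Lp ℂ p torusMeasure)) := by
  have : (HpTorus p : Set (Lp ℂ p torusMeasure)) = ⋂ (α : ℕ →₀ ℤ) (_ : ∃ i, α i < 0),
      {f | fourierCLM p α f = 0} := by
    ext f
    simp only [Set.mem_iInter, Set.mem_ofPred_eq]
    exact mem_hpTorus
  rw [this]
  exact isClosed_iInter fun α => isClosed_iInter fun _ =>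
    isClosed_eq (fourierCLM p α).continuous continuous_const

instance instCompleteSpaceHpTorus (p : ℝ≥0∞) [Fact (1 ≤ p)] : CompleteSpace (HpTorus p) :=
  (isClosed_hpTorus p).completeSpace_coe

theorem natIndex_apply (α : ℕ →₀ ℕ) (i : ℕ) : natIndex α i = α i := rfl

theorem natIndex_injective : Function.Injective natIndex := fun α β h => by
  ext i
  have := DFunLike.congr_fun h i
  rw [natIndex_apply, natIndex_apply] at this
  exact_mod_cast this

theorem exists_natIndex_eq {α : ℕ →₀ ℤ} (h : ∀ i, 0 ≤ α i) : ∃ β, natIndex β = α :=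
  ⟨α.mapRange Int.toNat rfl, by ext i; simp [natIndex_apply, h i]⟩

/-- The monomial `w^α` as an element of `H_p(𝕋^∞)`. -/
def hpTorusMonomial (p : ℝ≥0∞) [Fact (1 ≤ p)] (α : ℕ →₀ ℕ) : HpTorus p :=
  ⟨torusCharLp p (natIndex α), fun β hβ => by
    rw [fourierCoeff_torusCharLp, if_neg]
    rintro rfl
    obtain ⟨i, hi⟩ := hβ
    rw [natIndex_apply] at hi
    omega⟩

/-- Analytic polynomials are dense in `H_p(𝕋^∞)`. -/
theorem dense_span_hpTorusMonomial {p : ℝ≥0∞} [Fact (1 ≤ p)] (hp : p ≠ ∞) :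
    Dense (Submodule.span ℂ (Set.range (hpTorusMonomial p)) : Set (HpTorus p)) := by
  intro f
  refine Metric.mem_closure_iff.2 fun ε hε => ?_
  obtain ⟨k, hk⟩ := exists_multiplier_near hp (f : Lp ℂ p torusMeasure) (half_pos hε)
  have hterm : ∀ γ : ℕ →₀ ℤ, ∃ g ∈ Submodule.span ℂ (Set.range (hpTorusMonomial p)),
      (g : Lp ℂ p torusMeasure) = (k γ * fourierCoeff (f : Lp ℂ p torusMeasure) (-γ)) •
        torusCharLp p (-γ) := fun γ => by
    -- The approximant only rescales the Fourier coefficients of `f`, so its non-analytic terms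
    -- vanish along with those of `f`.
    by_cases hγ : ∃ i, (-γ) i < 0
    · exact ⟨0, Submodule.zero_mem _, by rw [f.2 _ hγ]; simp⟩
    · simp only [not_exists, not_lt] at hγ
      obtain ⟨β, hβ⟩ := exists_natIndex_eq hγ
      refine ⟨(k γ * fourierCoeff (f : Lp ℂ p torusMeasure) (-γ)) • hpTorusMonomial p β,
        Submodule.smul_mem _ _ (Submodule.subset_span ⟨β, rfl⟩), ?_⟩
      rw [← hβ]
      rfl
  choose g hg hgeq using hterm
  refine ⟨∑ γ ∈ k.support, g γ, Submodule.sum_mem _ fun γ _ => hg γ, ?_⟩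
  refine lt_of_le_of_lt ?_ (half_lt_self hε)
  rw [dist_eq_norm]
  change ‖((f - ∑ γ ∈ k.support, g γ : HpTorus p) : Lp ℂ p torusMeasure)‖ ≤ _
  rw [Lp.norm_def]
  refine ENNReal.toReal_le_of_le_ofReal (half_pos hε).le (le_trans (le_of_eq ?_) hk)
  refine eLpNorm_congr_ae ?_
  have hsum : ((f - ∑ γ ∈ k.support, g γ : HpTorus p) : Lp ℂ p torusMeasure)
      = (f : Lp ℂ p torusMeasure) - ∑ γ ∈ k.support,
        (k γ * fourierCoeff (f : Lp ℂ p torusMeasure) (-γ)) • torusCharLp p (-γ) := by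
    simp [hgeq]
  rw [hsum]
  have h1 : ∀ γ ∈ k.support, ∀ᵐ w ∂torusMeasure,
      ((k γ * fourierCoeff (f : Lp ℂ p torusMeasure) (-γ)) • torusCharLp p (-γ) :
        Lp ℂ p torusMeasure) w = k γ * (fourierCoeff (f : Lp ℂ p torusMeasure) (-γ) *
          (torusMonomial (-γ) w : ℂ)) := fun γ _ => by
    filter_upwards [Lp.coeFn_smul (k γ * fourierCoeff (f : Lp ℂ p torusMeasure) (-γ))
      (torusCharLp p (-γ)), coeFn_torusCharLp p (-γ)] with w h1 h2
    rw [h1, Pi.smul_apply, h2, smul_eq_mul, mul_assoc]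
  filter_upwards [Lp.coeFn_sub (f : Lp ℂ p torusMeasure) (∑ γ ∈ k.support,
    (k γ * fourierCoeff (f : Lp ℂ p torusMeasure) (-γ)) • torusCharLp p (-γ)),
    Lp.coeFn_finsetSum k.support (fun γ =>
      (k γ * fourierCoeff (f : Lp ℂ p torusMeasure) (-γ)) • torusCharLp p (-γ)),
    (Finset.eventually_all k.support).2 h1] with w h2 h3 h4
  rw [h2, Pi.sub_apply, h3, Finset.sum_apply]
  exact congrArg _ (Finset.sum_congr rfl fun γ hγ => h4 γ hγ)

/-! ### Uniform limits of holomorphic functions -/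

open Filter Topology in
/-- A uniform limit of holomorphic functions on an open subset of a complex normed space is
holomorphic. -/
theorem differentiableOn_of_uniformCauchySeqOn {E : Type*} [NormedAddCommGroup E]
    [NormedSpace ℂ E] {F : ℕ → E → ℂ} {f : E → ℂ} {U : Set E} (hU : IsOpen U)
    (hF : ∀ n, DifferentiableOn ℂ (F n) U) (hc : UniformCauchySeqOn F atTop U)
    (hf : ∀ x ∈ U, Tendsto (fun n => F n x) atTop (𝓝 (f x))) : DifferentiableOn ℂ f U := by
  intro x hx
  obtain ⟨δ, hδ, hball⟩ := Metric.isOpen_iff.1 hU x hx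
  have hδ2 : 0 < δ / 2 := half_pos hδ
  have hsub : ∀ y ∈ Metric.ball x (δ / 2), Metric.ball y (δ / 2) ⊆ U := fun y hy =>
    (Metric.ball_subset_ball' (by rw [Metric.mem_ball] at hy; linarith)).trans hball
  -- The Cauchy estimate on balls of radius `δ / 2`, all contained in `U`, makes the derivatives
  -- uniformly Cauchy.
  have hdc : UniformCauchySeqOn (fun n => fderiv ℂ (F n)) atTop (Metric.ball x (δ / 2)) := by
    rw [Metric.uniformCauchySeqOn_iff] at hc ⊢
    intro ε hε
    obtain ⟨N, hN⟩ := hc (ε * (δ / 2) / 4) (by positivity)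
    refine ⟨N, fun m hm n hn y hy => ?_⟩
    have hyU : y ∈ U := hsub y hy (Metric.mem_ball_self hδ2)
    have hd := (hF m).sub (hF n)
    have hfd : ∀ k, DifferentiableAt ℂ (F k) y := fun k => (hF k).differentiableAt (hU.mem_nhds hyU)
    rw [dist_eq_norm, ← fderiv_sub (hfd m) (hfd n)]
    refine (Complex.norm_fderiv_le_div_of_mapsTo_ball (hd.mono (hsub y hy))
      (R₂ := ε * (δ / 2) / 2) (fun z hz => ?_) hδ2).trans_lt ?_
    · have h1 := (hN m hm n hn z (hsub y hy hz)).le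
      have h2 := (hN m hm n hn y hyU).le
      rw [dist_eq_norm] at h1 h2
      rw [Metric.mem_closedBall, dist_eq_norm]
      refine (norm_sub_le _ _).trans ?_
      simp only [Pi.sub_apply]
      linarith
    · rw [div_lt_iff₀ hδ2]
      nlinarith [mul_pos hε hδ2]
  have hex : ∀ y, ∃ L, y ∈ Metric.ball x (δ / 2) →
      Tendsto (fun n => fderiv ℂ (F n) y) atTop (𝓝 L) := fun y => by
    by_cases hy : y ∈ Metric.ball x (δ / 2)
    · obtain ⟨L, hL⟩ := cauchySeq_tendsto_of_complete (hdc.cauchySeq hy)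
      exact ⟨L, fun _ => hL⟩
    · exact ⟨0, fun h => absurd h hy⟩
  choose g' hg' using hex
  have hmem := Metric.mem_ball_self (x := x) hδ2
  refine (hasFDerivAt_of_tendstoUniformlyOn Metric.isOpen_ball
    (hdc.tendstoUniformlyOn_of_tendsto hg') (fun n y hy => ?_)
    (fun y hy => hf y (hsub y hy (Metric.mem_ball_self hδ2)))
    hmem).differentiableAt.differentiableWithinAt
  exact ((hF n).differentiableAt (hU.mem_nhds
    (hsub y hy (Metric.mem_ball_self hδ2)))).hasFDerivAt

/-! ### Absolute convergence and holomorphy of the power series -/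

theorem hasSum_norm_sq (z : ellTwo) : HasSum (fun i => ‖z i‖ ^ 2) (‖z‖ ^ 2) := by
  have := lp.hasSum_norm (p := 2) (by simp) z
  simpa using this

/-- An `ℓ₂` sequence tends to zero, so only finitely many coordinates exceed `1/2`, and the largest
of these is still below `1`. -/
theorem exists_norm_le_of_mem_polydisc {z : ellTwo} (hz : z ∈ polydisc) :
    ∃ s : ℝ, s < 1 ∧ ∀ i, ‖z i‖ ≤ s := by
  have h := (hasSum_norm_sq z).summable.tendsto_cofinite_zero
  have hfin : {i | 1 / 2 < ‖z i‖}.Finite := by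
    have h1 := h.eventually (gt_mem_nhds (show (0 : ℝ) < 1 / 4 by norm_num))
    refine (Filter.eventually_cofinite.1 h1).subset fun i hi => ?_
    simp only [Set.mem_ofPred_eq] at hi ⊢
    nlinarith
  rcases hfin.toFinset.eq_empty_or_nonempty with he | hne
  · refine ⟨1 / 2, by norm_num, fun i => not_lt.1 fun hi => ?_⟩
    have : i ∈ hfin.toFinset := hfin.mem_toFinset.2 hi
    rw [he] at this
    exact absurd this (Finset.notMem_empty i)
  · obtain ⟨j, -, hj⟩ := hfin.toFinset.exists_max_image (fun i => ‖z i‖) hne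
    refine ⟨max (1 / 2) ‖z j‖, max_lt (by norm_num) (hz j), fun i => ?_⟩
    by_cases hi : 1 / 2 < ‖z i‖
    · exact (hj i (hfin.mem_toFinset.2 hi)).trans (le_max_right _ _)
    · exact (not_lt.1 hi).trans (le_max_left _ _)

theorem discMonomial_eq (α : ℕ →₀ ℕ) (z : polydisc) :
    discMonomial α z = seqMonomial α (fun i => (z : ellTwo) i) := rfl

theorem differentiable_seqMonomial (α : ℕ →₀ ℕ) :
    Differentiable ℂ fun z : ellTwo => seqMonomial α (fun i => z i) := by
  have h : ∀ i, Differentiable ℂ fun z : ellTwo => z i := fun i =>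
    (lp.evalCLM ℂ (fun _ : ℕ => ℂ) 2 i).differentiable
  exact fun z => (HasFDerivAt.finsetProd fun i _ =>
    ((h i).fun_pow (α i) z).hasFDerivAt).differentiableAt

theorem differentiable_seqPoly (F : Finset (ℕ →₀ ℕ)) (a : (ℕ →₀ ℕ) → ℂ) :
    Differentiable ℂ fun z : ellTwo => seqPoly F a (fun i => z i) := by
  unfold seqPoly
  exact Differentiable.fun_sum fun α _ => (differentiable_seqMonomial α).const_mul _

section

variable {p : ℝ≥0∞} [Fact (1 ≤ p)]

/-- The coefficient `f̂(α)` of a function in `H_p(𝕋^∞)`, as a linear functional. -/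
def hpCoeff (p : ℝ≥0∞) [Fact (1 ≤ p)] (α : ℕ →₀ ℕ) : HpTorus p →L[ℂ] ℂ :=
  (fourierCLM p (natIndex α)).comp (HpTorus p).subtypeL

theorem hpCoeff_apply (α : ℕ →₀ ℕ) (f : HpTorus p) :
    hpCoeff p α f = fourierCoeff (f : Lp ℂ p torusMeasure) (natIndex α) := rfl

theorem hpCoeff_hpTorusMonomial (α β : ℕ →₀ ℕ) :
    hpCoeff p β (hpTorusMonomial p α) = if α = β then 1 else 0 := by
  rw [hpCoeff_apply]
  refine (fourierCoeff_torusCharLp p _ _).trans ?_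
  simp only [natIndex_injective.eq_iff]

/-- The element of `H_p(𝕋^∞)` given by an analytic polynomial. -/
def hpPoly (p : ℝ≥0∞) [Fact (1 ≤ p)] (c : (ℕ →₀ ℕ) →₀ ℂ) : HpTorus p :=
  c.sum fun α a => a • hpTorusMonomial p α

theorem dense_range_hpPoly (hp : p ≠ ∞) : DenseRange (hpPoly p) := by
  refine (dense_span_hpTorusMonomial hp).mono fun f hf => ?_
  exact Finsupp.mem_span_range_iff_exists_finsupp.1 hf

theorem hpCoeff_hpPoly (c : (ℕ →₀ ℕ) →₀ ℂ) (β : ℕ →₀ ℕ) : hpCoeff p β (hpPoly p c) = c β := by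
  rw [hpPoly, Finsupp.sum, map_sum]
  simp only [map_smul, hpCoeff_hpTorusMonomial, smul_eq_mul, mul_ite, mul_one, mul_zero]
  rw [Finset.sum_ite_eq' c.support β c]
  simp [eq_comm]

theorem coeFn_hpPoly (c : (ℕ →₀ ℕ) →₀ ℂ) :
    ((hpPoly p c : HpTorus p) : Lp ℂ p torusMeasure) =ᵐ[torusMeasure]
      fun w => seqPoly c.support c (torusCoe w) := by
  have h0 : ((hpPoly p c : HpTorus p) : Lp ℂ p torusMeasure)
      = ∑ α ∈ c.support, c α • torusCharLp p (natIndex α) := by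
    rw [hpPoly, Finsupp.sum, Submodule.coe_sum]
    rfl
  have h1 : ∀ α ∈ c.support, ∀ᵐ w ∂torusMeasure,
      (c α • torusCharLp p (natIndex α) : Lp ℂ p torusMeasure) w
        = c α * seqMonomial α (torusCoe w) := fun α _ => by
    filter_upwards [Lp.coeFn_smul (c α) (torusCharLp p (natIndex α)),
      coeFn_torusCharLp p (natIndex α)] with w h1 h2
    rw [h1, Pi.smul_apply, h2, smul_eq_mul, seqMonomial_torusCoe]
  rw [h0]
  filter_upwards [Lp.coeFn_finsetSum c.support (fun α => c α • torusCharLp p (natIndex α)),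
    (Finset.eventually_all c.support).2 h1] with w h3 h4
  rw [h3, Finset.sum_apply]
  exact Finset.sum_congr rfl fun α hα => h4 α hα

theorem norm_hpPoly (c : (ℕ →₀ ℕ) →₀ ℂ) :
    ‖hpPoly p c‖ =
      (eLpNorm (fun w => seqPoly c.support c (torusCoe w)) p torusMeasure).toReal := by
  change ‖((hpPoly p c : HpTorus p) : Lp ℂ p torusMeasure)‖ = _
  rw [Lp.norm_def, eLpNorm_congr_ae (coeFn_hpPoly c)]

/-- The constant in the absolute convergence estimate. -/
def evalConst (s N : ℝ) : ℝ := Real.exp (2 / (1 - s) ^ 2 * N ^ 2)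

/-- For a finite `S` both sides are continuous in `f`, so it is enough to treat polynomials, where
the coefficient bound applies and `L_1 ≤ L_p`. The constant does not involve `S`, which gives
absolute convergence. -/
theorem sum_norm_le (hp : p ≠ ∞) (f : HpTorus p) {z : ellTwo} {s : ℝ} (hs : s < 1)
    (hz : ∀ i, ‖z i‖ ≤ s) (S : Finset (ℕ →₀ ℕ)) :
    ∑ α ∈ S, ‖hpCoeff p α f * seqMonomial α (fun i => z i)‖ ≤ evalConst s ‖z‖ * ‖f‖ := by
  refine (dense_range_hpPoly hp).induction_on
    (p := fun f => ∑ α ∈ S, ‖hpCoeff p α f * seqMonomial α (fun i => z i)‖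
      ≤ evalConst s ‖z‖ * ‖f‖) f (isClosed_le (by fun_prop) (by fun_prop)) fun c => ?_
  simp only [hpCoeff_hpPoly]
  have h1 : ∑ α ∈ S, ‖c α * seqMonomial α (fun i => z i)‖
      ≤ ∑ α ∈ c.support, ‖c α * seqMonomial α (fun i => z i)‖ := by
    rw [← Finset.sum_filter_ne_zero]
    refine Finset.sum_le_sum_of_subset_of_nonneg (fun α hα => ?_) fun _ _ _ => norm_nonneg _
    rw [Finsupp.mem_support_iff]
    exact fun h => (Finset.mem_filter.1 hα).2 (by simp [h])
  refine h1.trans ((sum_norm_seqMonomial_le hs hz (hasSum_norm_sq z).summable c.support c).trans ?_)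
  rw [(hasSum_norm_sq z).tsum_eq]
  refine mul_le_mul_of_nonneg_left ?_ (Real.exp_pos _).le
  refine le_trans (le_of_eq ?_) (integral_norm_le_norm (hpPoly p c : Lp ℂ p torusMeasure))
  exact (integral_congr_ae ((coeFn_hpPoly (p := p) c).mono fun w hw => by simp only [hw])).symm

/-- The sum `∑ f̂(α) z^α`. -/
def hpEval (f : HpTorus p) (z : ellTwo) : ℂ := ∑' α, hpCoeff p α f * seqMonomial α (fun i => z i)

theorem summable_hpEval (hp : p ≠ ∞) (f : HpTorus p) {z : ellTwo} (hz : z ∈ polydisc) :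
    Summable fun α => hpCoeff p α f * seqMonomial α (fun i => z i) := by
  obtain ⟨s, hs, hzs⟩ := exists_norm_le_of_mem_polydisc hz
  exact (summable_of_sum_le (fun _ => norm_nonneg _) (sum_norm_le hp f hs hzs)).of_norm

theorem norm_hpEval_le (hp : p ≠ ∞) (f : HpTorus p) {z : ellTwo} {s : ℝ} (hs : s < 1)
    (hz : ∀ i, ‖z i‖ ≤ s) : ‖hpEval f z‖ ≤ evalConst s ‖z‖ * ‖f‖ := by
  have h := summable_of_sum_le (fun _ => norm_nonneg _) (sum_norm_le hp f hs hz)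
  exact (norm_tsum_le_tsum_norm h).trans
    (Real.tsum_le_of_sum_le (fun _ => norm_nonneg _) (sum_norm_le hp f hs hz))

theorem hpEval_add (hp : p ≠ ∞) (f g : HpTorus p) {z : ellTwo} (hz : z ∈ polydisc) :
    hpEval (f + g) z = hpEval f z + hpEval g z := by
  simp only [hpEval, map_add, add_mul]
  exact (summable_hpEval hp f hz).tsum_add (summable_hpEval hp g hz)

theorem hpEval_smul (c : ℂ) (f : HpTorus p) (z : ellTwo) : hpEval (c • f) z = c * hpEval f z := by
  simp only [hpEval, map_smul, smul_eq_mul, mul_assoc, tsum_mul_left]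

theorem hpEval_sub (hp : p ≠ ∞) (f g : HpTorus p) {z : ellTwo} (hz : z ∈ polydisc) :
    hpEval (f - g) z = hpEval f z - hpEval g z := by
  simp only [hpEval, map_sub, sub_mul]
  exact (summable_hpEval hp f hz).tsum_sub (summable_hpEval hp g hz)

theorem hpEval_hpPoly (c : (ℕ →₀ ℕ) →₀ ℂ) (z : ellTwo) :
    hpEval (hpPoly p c) z = seqPoly c.support c (fun i => z i) := by
  simp only [hpEval, hpCoeff_hpPoly]
  rw [tsum_eq_sum (s := c.support)]
  · rfl
  · intro α hα
    rw [Finsupp.notMem_support_iff.1 hα, zero_mul]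

open Filter Topology in
theorem tendsto_hpEval (hp : p ≠ ∞) {f : HpTorus p} {u : ℕ → HpTorus p}
    (hu : Tendsto u atTop (𝓝 f)) {z : ellTwo} (hz : z ∈ polydisc) :
    Tendsto (fun n => hpEval (u n) z) atTop (𝓝 (hpEval f z)) := by
  obtain ⟨s, hs, hzs⟩ := exists_norm_le_of_mem_polydisc hz
  rw [tendsto_iff_norm_sub_tendsto_zero] at hu ⊢
  have h := hu.const_mul (evalConst s ‖z‖)
  rw [mul_zero] at h
  refine squeeze_zero (fun _ => norm_nonneg _) (fun n => ?_) h
  rw [← hpEval_sub hp _ _ hz]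
  exact norm_hpEval_le hp _ hs hzs

open Filter Topology in
theorem exists_seq_hpPoly (hp : p ≠ ∞) (f : HpTorus p) :
    ∃ c : ℕ → (ℕ →₀ ℕ) →₀ ℂ, Tendsto (fun n => hpPoly p (c n)) atTop (𝓝 f) := by
  have h : f ∈ closure (Set.range (hpPoly p)) := dense_range_hpPoly hp f
  obtain ⟨u, hu, hlim⟩ := mem_closure_iff_seq_limit.1 h
  choose c hc using hu
  exact ⟨c, by simpa only [hc] using hlim⟩

-- On the ball of radius `(1 - s) / 2` about `z`, the coordinates stay below `(1 + s) / 2` and the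
-- `ℓ₂` norm stays bounded. One evaluation constant `K` thus serves the whole ball, and polynomials
-- converging to `f` in norm are uniformly Cauchy there.
open Filter Topology in
theorem differentiableOn_hpEval (hp : p ≠ ∞) (f : HpTorus p) :
    DifferentiableOn ℂ (hpEval f) polydisc := by
  intro z hz
  obtain ⟨s, hs, hzs⟩ := exists_norm_le_of_mem_polydisc hz
  have hδ : 0 < (1 - s) / 2 := by linarith
  have hs1 : (1 + s) / 2 < 1 := by linarith
  have hball : ∀ y ∈ Metric.ball z ((1 - s) / 2), ∀ i, ‖y i‖ ≤ (1 + s) / 2 := fun y hy i => by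
    have h1 : ‖(y - z) i‖ ≤ ‖y - z‖ := lp.norm_apply_le_norm two_ne_zero _ i
    rw [Metric.mem_ball, dist_eq_norm] at hy
    have h2 : y i = z i + (y - z) i := by simp
    rw [h2]
    refine (norm_add_le _ _).trans ?_
    linarith [hzs i]
  have hpoly : ∀ y ∈ Metric.ball z ((1 - s) / 2), y ∈ polydisc := fun y hy i =>
    (hball y hy i).trans_lt hs1
  have hnorm : ∀ y ∈ Metric.ball z ((1 - s) / 2),
      evalConst ((1 + s) / 2) ‖y‖ ≤ evalConst ((1 + s) / 2) (‖z‖ + (1 - s) / 2) := fun y hy => by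
    rw [Metric.mem_ball, dist_eq_norm] at hy
    refine Real.exp_le_exp.2 (mul_le_mul_of_nonneg_left ?_ (by positivity))
    refine pow_le_pow_left₀ (norm_nonneg _) ?_ 2
    have := norm_add_le z (y - z)
    rw [add_sub_cancel] at this
    linarith
  set K := evalConst ((1 + s) / 2) (‖z‖ + (1 - s) / 2)
  have hK : 0 < K := Real.exp_pos _
  obtain ⟨c, hc⟩ := exists_seq_hpPoly hp f
  have hcau : UniformCauchySeqOn (fun n => hpEval (hpPoly p (c n))) atTop
      (Metric.ball z ((1 - s) / 2)) := by
    rw [Metric.uniformCauchySeqOn_iff]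
    intro ε hε
    obtain ⟨N, hN⟩ := Metric.cauchySeq_iff.1 hc.cauchySeq (ε / K) (div_pos hε hK)
    refine ⟨N, fun m hm n hn y hy => ?_⟩
    have h1 := hN m hm n hn
    rw [dist_eq_norm] at h1 ⊢
    rw [← hpEval_sub hp _ _ (hpoly y hy)]
    refine (norm_hpEval_le hp _ hs1 (hball y hy)).trans_lt ?_
    refine (mul_le_mul_of_nonneg_right (hnorm y hy) (norm_nonneg _)).trans_lt ?_
    rwa [lt_div_iff₀ hK, mul_comm] at h1
  have hd := differentiableOn_of_uniformCauchySeqOn Metric.isOpen_ball (fun n => ?_) hcau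
    (fun y hy => tendsto_hpEval hp hc (hpoly y hy))
  · exact (hd.differentiableAt (Metric.ball_mem_nhds z hδ)).differentiableWithinAt
  · have : hpEval (hpPoly p (c n)) = fun y => seqPoly (c n).support (c n) (fun i => y i) :=
      funext fun y => hpEval_hpPoly _ _
    rw [this]
    exact (differentiable_seqPoly _ _).differentiableOn

end

/-! ### Shrinking the radii contracts the `L_p` norm -/

/-- The point `(x_i w_i)_i`. -/
def scaledPoint (x : ℕ → ℝ) (w : ℕ → Circle) : ℕ → ℂ := fun i => (x i : ℂ) * torusCoe w i

/-- The sequence of radii `(r, …, r, 0, 0, …)`. -/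
def radii (n : ℕ) (r : ℝ) : ℕ → ℝ := fun i => if i < n then r else 0

theorem continuous_scaledPoint (x : ℕ → ℝ) : Continuous (scaledPoint x) := by
  have := continuous_torusCoe
  unfold scaledPoint; fun_prop

theorem torusPoint_torusRestrict_apply (n : ℕ) (r : Set.Ioo (0 : ℝ) 1) (w : ℕ → Circle) (i : ℕ) :
    ((torusPoint r (torusRestrict n w) : polydisc) : ellTwo) i = scaledPoint (radii n r) w i := by
  change finPoint _ i = _
  rw [finPoint_apply, scaledPoint, radii]
  split_ifs <;> simp [torusRestrict, torusCoe]

theorem eLpNorm_torusPoint {p : ℝ≥0∞} {g : polydisc → ℂ} (hg : IsHolomorphic g) (n : ℕ)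
    (r : Set.Ioo (0 : ℝ) 1) :
    eLpNorm (fun w : Fin n → Circle => g (torusPoint r w)) p (torusMeasureFin n)
      = eLpNorm (fun w => g (torusPoint r (torusRestrict n w))) p torusMeasure :=
  (eLpNorm_comp_measurePreserving (hg.aestronglyMeasurable r)
    (measurePreserving_torusRestrict n)).symm

theorem scaledPoint_mul_mulSingle (x : ℕ → ℝ) (w : ℕ → Circle) (i : ℕ) (v : Circle) :
    scaledPoint x (w * Pi.mulSingle i v)
      = fun j => scaledPoint x w j * (Function.update 1 i (v : ℂ) : ℕ → ℂ) j := by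
  funext j
  simp only [scaledPoint, torusCoe_mul_mulSingle, mul_assoc]

theorem scaledPoint_update (x : ℕ → ℝ) (w : ℕ → Circle) (i : ℕ) (ρ : ℝ) :
    scaledPoint (Function.update x i (ρ * x i)) w
      = fun j => scaledPoint x w j * (Function.update 1 i (ρ : ℂ) : ℕ → ℂ) j := by
  funext j
  by_cases hj : j = i
  · subst hj; simp [scaledPoint]; ring
  · simp [scaledPoint, hj]

/-- Averaging over the `i`-th coordinate against a Poisson kernel shrinks the `i`-th radius. -/
theorem integral_scaledPoint_mulSingle {H : (ℕ → ℂ) → ℂ} {x : ℕ → ℝ} {w : ℕ → Circle} {i : ℕ}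
    (hH : DifferentiableOn ℂ (fun t => H fun j => scaledPoint x w j *
      (Function.update 1 i t : ℕ → ℂ) j) (Metric.closedBall 0 1)) (ρ : Set.Ico (0 : ℝ) 1) :
    ∫ v, H (scaledPoint x (w * Pi.mulSingle i (circleBlaschke ρ v))) ∂circleMeasure
      = H (scaledPoint (Function.update x i (ρ * x i)) w) := by
  simp only [scaledPoint_mul_mulSingle, scaledPoint_update]
  exact integral_circleBlaschke hH ρ

theorem seqPoly_mul_update (F : Finset (ℕ →₀ ℕ)) (a : (ℕ →₀ ℕ) → ℂ) (y : ℕ → ℂ) (i : ℕ) (t : ℂ) :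
    seqPoly F a (fun j => y j * (Function.update 1 i t : ℕ → ℂ) j)
      = ∑ α ∈ F, a α * seqMonomial α y * t ^ α i := by
  simp only [seqPoly, seqMonomial_mul, seqMonomial_update_one, mul_assoc]

theorem seqMonomial_congr {α : ℕ →₀ ℕ} {y z : ℕ → ℂ} (h : ∀ i ∈ α.support, y i = z i) :
    seqMonomial α y = seqMonomial α z :=
  Finset.prod_congr rfl fun i hi => by simp only [h i hi]

theorem scaledPoint_one (w : ℕ → Circle) : scaledPoint (fun _ => 1) w = torusCoe w := by
  funext i
  simp [scaledPoint]

theorem measurable_mulSingle_circleBlaschke (i : ℕ) (ρ : Set.Ico (0 : ℝ) 1) :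
    Measurable fun v : Circle => (Pi.mulSingle i (circleBlaschke ρ v) : ℕ → Circle) :=
  ((continuous_mulSingle i).comp (continuous_circleBlaschke ρ)).measurable

/-- The radii are lowered from `1` to `x i` one coordinate at a time; each step is a Poisson average
of translates and so a contraction. Only the finitely many coordinates occurring in `F` matter. -/
theorem eLpNorm_seqPoly_scaledPoint_le {p : ℝ≥0∞} (hp1 : 1 ≤ p) (hp : p ≠ ∞)
    (F : Finset (ℕ →₀ ℕ)) (a : (ℕ →₀ ℕ) → ℂ) {x : ℕ → ℝ} (hx : ∀ i, x i ∈ Set.Ico (0 : ℝ) 1) :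
    eLpNorm (fun w => seqPoly F a (scaledPoint x w)) p torusMeasure
      ≤ eLpNorm (fun w => seqPoly F a (torusCoe w)) p torusMeasure := by
  have key : ∀ S : Finset ℕ,
      eLpNorm (fun w => seqPoly F a (scaledPoint (fun j => if j ∈ S then x j else 1) w)) p
        torusMeasure ≤ eLpNorm (fun w => seqPoly F a (torusCoe w)) p torusMeasure := fun S => by
    induction S using Finset.induction_on with
    | empty => simp [scaledPoint_one]
    | insert i S hi ih =>
      refine le_trans ?_ ih
      set y : ℕ → ℝ := fun j => if j ∈ S then x j else 1 with hy
      have hyi : (fun j => if j ∈ insert i S then x j else 1)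
          = Function.update y i (x i * y i) := by
        funext j
        by_cases hj : j = i
        · subst hj; simp [hy, hi]
        · simp [hy, hj]
      have hc : Continuous fun w => seqPoly F a (scaledPoint y w) :=
        (continuous_seqPoly F a).comp (continuous_scaledPoint y)
      refine le_trans (le_of_eq ?_) (eLpNorm_average_le (ν := circleMeasure) hp1 hp
        hc.stronglyMeasurable (measurable_mulSingle_circleBlaschke i ⟨x i, hx i⟩))
      congr 1
      funext w
      rw [hyi, integral_scaledPoint_mulSingle]
      simp only [seqPoly_mul_update]
      fun_prop
  refine le_trans (le_of_eq ?_) (key (F.sup Finsupp.support))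
  congr 1
  funext w
  refine Finset.sum_congr rfl fun α hα => ?_
  congr 1
  refine seqMonomial_congr fun i hi => ?_
  have : i ∈ F.sup Finsupp.support := (Finset.le_sup (f := Finsupp.support) hα) hi
  simp only [scaledPoint, this, if_true]

theorem radii_mem (n : ℕ) (r : Set.Ioo (0 : ℝ) 1) (i : ℕ) : radii n r i ∈ Set.Ico (0 : ℝ) 1 := by
  unfold radii
  split_ifs
  · exact ⟨r.2.1.le, r.2.2⟩
  · exact ⟨le_rfl, one_pos⟩

/-- A sequence of radii increasing to `1`. -/
def radiusSeq (k : ℕ) : Set.Ioo (0 : ℝ) 1 :=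
  ⟨1 - 1 / ((k : ℝ) + 2), by
    have : 1 / ((k : ℝ) + 2) < 1 := by
      rw [div_lt_one (by positivity)]
      have : (0 : ℝ) ≤ k := Nat.cast_nonneg k
      linarith
    have h2 : 0 < 1 / ((k : ℝ) + 2) := by positivity
    constructor <;> linarith⟩

open Filter Topology in
theorem tendsto_radiusSeq : Tendsto (fun k => (radiusSeq k : ℝ)) atTop (𝓝 1) := by
  have h : Tendsto (fun k : ℕ => 1 / ((k : ℝ) + 2)) atTop (𝓝 0) := by
    have := tendsto_one_div_add_atTop_nhds_zero_nat (𝕜 := ℝ)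
    refine squeeze_zero (fun k => by positivity) (fun k => ?_) this
    exact one_div_le_one_div_of_le (by positivity) (by linarith)
  simpa [radiusSeq] using h.const_sub 1

open Filter Topology in
theorem tendsto_scaledPoint_radii (w : ℕ → Circle) :
    Tendsto (fun k => scaledPoint (radii k (radiusSeq k)) w) atTop (𝓝 (torusCoe w)) := by
  refine tendsto_pi_nhds.2 fun i => ?_
  have h : Tendsto (fun k => ((radiusSeq k : ℝ) : ℂ) * torusCoe w i) atTop
      (𝓝 (torusCoe w i)) := by
    have := ((Complex.continuous_ofReal.tendsto 1).comp tendsto_radiusSeq).mul_const (torusCoe w i)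
    simpa using this
  refine h.congr' ?_
  filter_upwards [eventually_gt_atTop i] with k hk
  simp [scaledPoint, radii, hk]

/-! ### The isometry and its range -/

section

variable {p : ℝ≥0∞} [hp1 : Fact (1 ≤ p)]

/-- The function `∑ f̂(α) z^α` on the domain `𝔻^∞ ∩ ℓ₂`. -/
def hpExtension (f : HpTorus p) (z : polydisc) : ℂ := hpEval f z

theorem isHolomorphic_hpExtension (hp : p ≠ ∞) (f : HpTorus p) : IsHolomorphic (hpExtension f) :=
  ⟨hpEval f, differentiableOn_hpEval hp f, fun _ => rfl⟩

theorem hpExtension_hpPoly_torusPoint (c : (ℕ →₀ ℕ) →₀ ℂ) (n : ℕ) (r : Set.Ioo (0 : ℝ) 1)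
    (w : ℕ → Circle) : hpExtension (hpPoly p c) (torusPoint r (torusRestrict n w))
      = seqPoly c.support c (scaledPoint (radii n r) w) := by
  rw [hpExtension, hpEval_hpPoly]
  simp only [torusPoint_torusRestrict_apply]

theorem eLpNorm_hpExtension_hpPoly_le (hp : p ≠ ∞) (c : (ℕ →₀ ℕ) →₀ ℂ) (n : ℕ)
    (r : Set.Ioo (0 : ℝ) 1) :
    eLpNorm (fun w => hpExtension (hpPoly p c) (torusPoint r (torusRestrict n w))) p torusMeasure
      ≤ ENNReal.ofReal ‖hpPoly p c‖ := by
  rw [norm_hpPoly, ENNReal.ofReal_toReal]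
  · simp only [hpExtension_hpPoly_torusPoint]
    exact eLpNorm_seqPoly_scaledPoint_le hp1.out hp _ _ (radii_mem n r)
  · exact (memLp_of_continuous p (continuous_seqPoly_torusCoe _ _)).eLpNorm_ne_top

-- Polynomials approximating `f` in norm have extensions converging at every point, so Fatou's lemma
-- carries their bound over to `f`.
open Filter Topology in
theorem eLpNorm_hpExtension_le (hp : p ≠ ∞) (f : HpTorus p) (n : ℕ) (r : Set.Ioo (0 : ℝ) 1) :
    eLpNorm (fun w => hpExtension f (torusPoint r (torusRestrict n w))) p torusMeasure
      ≤ ENNReal.ofReal ‖f‖ := by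
  obtain ⟨c, hc⟩ := exists_seq_hpPoly hp f
  refine ENNReal.le_of_forall_pos_le_add fun ε hε _ => ?_
  refine Lp.eLpNorm_le_of_ae_tendsto (u := atTop)
    (f := fun k w => hpExtension (hpPoly p (c k)) (torusPoint r (torusRestrict n w))) ?_
    (fun k => ?_) (Eventually.of_forall fun w => tendsto_hpEval hp hc (torusPoint r _).2)
  · have h1 : ∀ᶠ k in atTop, ‖hpPoly p (c k)‖ < ‖f‖ + ε :=
      hc.norm.eventually (gt_mem_nhds (by simpa using hε))
    filter_upwards [h1] with k hk
    refine (eLpNorm_hpExtension_hpPoly_le hp (c k) n r).trans ?_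
    refine (ENNReal.ofReal_le_ofReal hk.le).trans ?_
    refine ENNReal.ofReal_add_le.trans (le_of_eq ?_)
    rw [ENNReal.ofReal_coe_nnreal]
  · exact ((isHolomorphic_hpExtension hp _).continuous.comp ((continuous_torusPoint r).comp
      (continuous_torusRestrict n))).aestronglyMeasurable

theorem hpNorm_hpExtension_le (hp : p ≠ ∞) (f : HpTorus p) :
    hpNorm p (hpExtension f) ≤ ENNReal.ofReal ‖f‖ :=
  iSup₂_le fun n r => by
    rw [eLpNorm_torusPoint (isHolomorphic_hpExtension hp f)]
    exact eLpNorm_hpExtension_le hp f n r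

/-- Fatou's lemma on the boundary torus: a polynomial is continuous in the product topology, and the
points with `k` coordinates of radius `radiusSeq k` converge coordinatewise to the boundary point.
-/
theorem le_hpNorm_hpExtension_hpPoly (hp : p ≠ ∞) (c : (ℕ →₀ ℕ) →₀ ℂ) :
    ENNReal.ofReal ‖hpPoly p c‖ ≤ hpNorm p (hpExtension (hpPoly p c)) := by
  rw [norm_hpPoly, ENNReal.ofReal_toReal
    (memLp_of_continuous p (continuous_seqPoly_torusCoe _ _)).eLpNorm_ne_top]
  refine Lp.eLpNorm_le_of_ae_tendsto (u := Filter.atTop)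
    (f := fun k w => seqPoly c.support c (scaledPoint (radii k (radiusSeq k)) w))
    (Filter.Eventually.of_forall fun k => ?_) (fun k => ?_)
    (Filter.Eventually.of_forall fun w => ((continuous_seqPoly _ _).tendsto _).comp
      (tendsto_scaledPoint_radii w))
  · simp only [← hpExtension_hpPoly_torusPoint (p := p)]
    rw [← eLpNorm_torusPoint (isHolomorphic_hpExtension hp _)]
    exact eLpNorm_le_hpNorm p _ k (radiusSeq k)
  · exact ((continuous_seqPoly _ _).comp (continuous_scaledPoint _)).aestronglyMeasurable

/-- The map `f ↦ ∑ f̂(α) z^α` as a linear map. -/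
def hpExtensionLM (p : ℝ≥0∞) [hp1 : Fact (1 ≤ p)] (hp : p ≠ ∞) : HpTorus p →ₗ[ℂ] HpDisc p where
  toFun f := ⟨hpExtension f, isHolomorphic_hpExtension hp f,
    (hpNorm_hpExtension_le hp f).trans_lt ENNReal.ofReal_lt_top⟩
  map_add' f g := Subtype.ext (funext fun z => hpEval_add hp f g z.2)
  map_smul' c f := Subtype.ext (funext fun z => hpEval_smul c f z)

theorem norm_hpExtensionLM_le (hp : p ≠ ∞) (f : HpTorus p) : ‖hpExtensionLM p hp f‖ ≤ ‖f‖ :=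
  ENNReal.toReal_le_of_le_ofReal (norm_nonneg f) (hpNorm_hpExtension_le hp f)

theorem norm_hpExtensionLM (hp : p ≠ ∞) (f : HpTorus p) : ‖hpExtensionLM p hp f‖ = ‖f‖ := by
  have hc : Continuous (hpExtensionLM p hp) :=
    AddMonoidHomClass.continuous_of_bound (hpExtensionLM p hp) 1
      fun f => by simpa using norm_hpExtensionLM_le hp f
  refine (dense_range_hpPoly hp).induction_on (p := fun f => ‖hpExtensionLM p hp f‖ = ‖f‖) f
    (isClosed_eq hc.norm continuous_norm) fun c => ?_
  refine le_antisymm (norm_hpExtensionLM_le hp _) ?_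
  rw [norm_hpDisc_def, ← ENNReal.ofReal_le_iff_le_toReal]
  · exact le_hpNorm_hpExtension_hpPoly hp c
  · exact (hpExtensionLM p hp (hpPoly p c)).2.2.ne

/-- The isometry `f ↦ ∑ f̂(α) z^α` of `H_p(𝕋^∞)` into `H_p(𝔻^∞)`. -/
def hpExtensionLI (p : ℝ≥0∞) [hp1 : Fact (1 ≤ p)] (hp : p ≠ ∞) : HpTorus p →ₗᵢ[ℂ] HpDisc p where
  toLinearMap := hpExtensionLM p hp
  norm_map' := norm_hpExtensionLM hp

theorem hpExtensionLI_hpTorusMonomial (hp : p ≠ ∞) (α : ℕ →₀ ℕ) :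
    hpExtensionLI p hp (hpTorusMonomial p α) = hpMonomial p α := by
  refine Subtype.ext (funext fun z => ?_)
  change hpEval (hpTorusMonomial p α) z = discMonomial α z
  rw [hpEval, discMonomial_eq, tsum_eq_single α]
  · simp [hpCoeff_hpTorusMonomial]
  · intro β hβ
    rw [hpCoeff_hpTorusMonomial, if_neg hβ.symm, zero_mul]

/-- The isometric image of a complete space is closed, and the dense analytic polynomials are sent
onto the span of the monomials. -/
theorem range_hpExtensionLI (hp : p ≠ ∞) :
    Set.range (hpExtensionLI p hp) =
      closure (Submodule.span ℂ (Set.range (hpMonomial p)) : Set (HpDisc p)) := by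
  have himg : hpExtensionLI p hp '' (Submodule.span ℂ (Set.range (hpTorusMonomial p)))
      = (Submodule.span ℂ (Set.range (hpMonomial p)) : Set (HpDisc p)) := by
    have h := Submodule.map_span (hpExtensionLI p hp).toLinearMap (Set.range (hpTorusMonomial p))
    rw [← Set.range_comp] at h
    have h2 : (hpExtensionLI p hp).toLinearMap ∘ hpTorusMonomial p = hpMonomial p :=
      funext fun α => hpExtensionLI_hpTorusMonomial hp α
    rw [h2] at h
    rw [← h]
    rfl
  rw [← himg]
  refine subset_antisymm ?_ ?_
  · rw [← Set.image_univ, ← (dense_span_hpTorusMonomial hp).closure_eq]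
    exact image_closure_subset_closure_image (hpExtensionLI p hp).continuous
  · exact closure_minimal (Set.image_subset_range _ _)
      (hpExtensionLI p hp).isometry.isClosedEmbedding.isClosed_range

end

/-! ### Weak limits of bounded sequences in `L_p`, by truncation to `L_2` -/

open Filter Topology in
/-- Bounded sequences in a Hilbert space converge weakly along ultrafilters. -/
theorem exists_weak_limit {E : Type*} [NormedAddCommGroup E] [InnerProductSpace ℂ E]
    [CompleteSpace E] (𝒰 : Ultrafilter ℕ) {x : ℕ → E} {C : ℝ} (hx : ∀ k, ‖x k‖ ≤ C) :
    ∃ y, ∀ e, Tendsto (fun k => inner ℂ e (x k)) 𝒰 (𝓝 (inner ℂ e y)) := by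
  let T : ℕ → WeakDual ℂ E := fun k => StrongDual.toWeakDual (InnerProductSpace.toDual ℂ E (x k))
  have hmem : ∀ k, T k ∈ WeakDual.toStrongDual ⁻¹' Metric.closedBall (0 : StrongDual ℂ E) C :=
    fun k => by
      change InnerProductSpace.toDual ℂ E (x k) ∈ Metric.closedBall (0 : StrongDual ℂ E) C
      simpa using hx k
  obtain ⟨L, -, hL⟩ := (isCompact_iff_ultrafilter_le_nhds.1
    (WeakDual.isCompact_closedBall (𝕜 := ℂ) (E := E) 0 C)) (𝒰.map T)
    (by
      rw [Ultrafilter.coe_map, le_principal_iff]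
      exact Filter.mem_map.2 (univ_mem' hmem))
  refine ⟨(InnerProductSpace.toDual ℂ E).symm (WeakDual.toStrongDual L), fun e => ?_⟩
  have h1 : Tendsto T 𝒰 (𝓝 L) := hL
  have h2 := ((WeakDual.eval_continuous e).tendsto L).comp h1
  have h3 := (Complex.continuous_conj.tendsto _).comp h2
  have h4 : ∀ z : E, starRingEnd ℂ (inner ℂ z e) = inner ℂ e z := fun z => inner_conj_symm _ _
  rw [← h4, InnerProductSpace.toDual_symm_apply]
  refine h3.congr fun k => ?_
  rw [← h4]
  rfl

-- Hahn–Banach: a closed convex set is weakly closed. It is applied to sets of `L_2` functions cut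
-- out by an `L_q` bound, so that such bounds survive weak `L_2` limits.
open Filter Topology in
theorem mem_of_weak_limit {E : Type*} [NormedAddCommGroup E] [InnerProductSpace ℂ E]
    [CompleteSpace E] {l : Filter ℕ} [NeBot l] {x : ℕ → E} {y : E}
    (h : ∀ e, Tendsto (fun k => inner ℂ e (x k)) l (𝓝 (inner ℂ e y))) {K : Set E}
    (hK : Convex ℝ K) (hKc : IsClosed K) (hx : ∀ k, x k ∈ K) : y ∈ K := by
  by_contra hy
  obtain ⟨f, u, hf, hu⟩ := RCLike.geometric_hahn_banach_closed_point (𝕜 := ℂ) hK hKc hy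
  obtain ⟨e, rfl⟩ := (InnerProductSpace.toDual ℂ E).surjective f
  simp only [InnerProductSpace.toDual_apply_apply] at hf hu
  refine absurd hu (not_lt.2 ?_)
  exact le_of_tendsto ((Complex.continuous_re.tendsto _).comp (h e))
    (Eventually.of_forall fun k => (hf _ (hx k)).le)

section Weak

variable {Ω : Type*} [MeasurableSpace Ω] {μ : Measure Ω}

theorem convex_setOf_eLpNorm_le {q : ℝ≥0∞} (hq : 1 ≤ q) (C : ℝ≥0∞) :
    Convex ℝ {h : Lp ℂ 2 μ | eLpNorm h q μ ≤ C} := by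
  intro f hf g hg a b ha hb hab
  have hr : ∀ {r : ℝ} (h : Lp ℂ 2 μ), 0 ≤ r → eLpNorm h q μ ≤ C →
      eLpNorm (r • h : Lp ℂ 2 μ) q μ ≤ ENNReal.ofReal r * C := fun {r} h hr0 hh => by
    rw [eLpNorm_congr_ae (Lp.coeFn_smul r h), eLpNorm_const_smul, Real.enorm_of_nonneg hr0]
    gcongr
  change eLpNorm (a • f + b • g : Lp ℂ 2 μ) q μ ≤ C
  rw [eLpNorm_congr_ae (Lp.coeFn_add _ _)]
  refine (eLpNorm_add_le (Lp.aestronglyMeasurable _) (Lp.aestronglyMeasurable _) hq).trans ?_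
  refine (add_le_add (hr f ha hf) (hr g hb hg)).trans (le_of_eq ?_)
  rw [← add_mul, ← ENNReal.ofReal_add ha hb, hab, ENNReal.ofReal_one, one_mul]

-- Convergence in `L_r` yields an almost everywhere convergent subsequence, to which Fatou's lemma
-- applies in `L_q`.
open Filter Topology in
theorem eLpNorm_le_of_tendsto_eLpNorm {r q C : ℝ≥0∞} (hr : r ≠ 0) {f : ℕ → Ω → ℂ} {g : Ω → ℂ}
    (hf : ∀ n, AEStronglyMeasurable (f n) μ) (hg : AEStronglyMeasurable g μ)
    (h : Tendsto (fun n => eLpNorm (f n - g) r μ) atTop (𝓝 0))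
    (hC : ∀ n, eLpNorm (f n) q μ ≤ C) : eLpNorm g q μ ≤ C := by
  obtain ⟨ns, -, hns⟩ :=
    (tendstoInMeasure_of_tendsto_eLpNorm hr hf hg h).exists_seq_tendsto_ae
  exact Lp.eLpNorm_le_of_ae_tendsto (u := atTop) (Eventually.of_forall fun n => hC (ns n))
    (fun n => hf (ns n)) hns

open Filter Topology in
theorem isClosed_setOf_eLpNorm_le (q C : ℝ≥0∞) :
    IsClosed {h : Lp ℂ 2 μ | eLpNorm h q μ ≤ C} := by
  refine IsSeqClosed.isClosed fun u f hu huf => ?_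
  exact eLpNorm_le_of_tendsto_eLpNorm two_ne_zero (fun n => Lp.aestronglyMeasurable _)
    (Lp.aestronglyMeasurable _) (Lp.tendsto_Lp_iff_tendsto_eLpNorm' _ _ |>.1 huf) hu

/-- Truncation of a complex number at modulus `R`. -/
def truncate (R : ℝ) (z : ℂ) : ℂ := if ‖z‖ ≤ R then z else 0

theorem measurable_truncate (R : ℝ) : Measurable (truncate R) :=
  Measurable.ite (measurableSet_le measurable_norm measurable_const) measurable_id measurable_const

theorem norm_truncate_le (R : ℝ) (z : ℂ) : ‖truncate R z‖ ≤ ‖z‖ := by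
  unfold truncate; split_ifs <;> simp

theorem norm_truncate_le_radius {R : ℝ} (hR : 0 ≤ R) (z : ℂ) : ‖truncate R z‖ ≤ R := by
  unfold truncate; split_ifs with h
  · exact h
  · simpa using hR

theorem norm_sub_truncate_le {R q : ℝ} (hR : 0 < R) (hq : 1 ≤ q) (z : ℂ) :
    ‖z - truncate R z‖ ≤ R ^ (1 - q) * ‖z‖ ^ q := by
  unfold truncate
  split_ifs with h
  · simp only [sub_self, norm_zero]; positivity
  · have hz : 0 < ‖z‖ := hR.trans (not_le.1 h)
    rw [sub_zero]
    calc ‖z‖ = ‖z‖ ^ (1 - q) * ‖z‖ ^ q := by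
          rw [← Real.rpow_add hz, sub_add_cancel, Real.rpow_one]
      _ ≤ R ^ (1 - q) * ‖z‖ ^ q := by
          refine mul_le_mul_of_nonneg_right ?_ (by positivity)
          exact Real.rpow_le_rpow_of_nonpos hR (not_le.1 h).le (by linarith)

-- Uniform integrability of an `L_p` ball: the discarded part has `L_1` norm at most `R ^ (1 - p) M
-- ^ p`, which tends to zero with `1 / R` exactly because `p > 1`. This is where the argument
-- excludes `p = 1`.
open Filter Topology in
theorem exists_truncate_radius {p M : ℝ≥0∞} (hp1 : 1 < p) (hp : p ≠ ∞) (hM : M ≠ ∞) {η : ℝ≥0∞}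
    (hη : η ≠ 0) : ∃ R : ℝ, 0 < R ∧ ∀ h : Ω → ℂ, eLpNorm h p μ ≤ M →
      eLpNorm (fun w => h w - truncate R (h w)) 1 μ ≤ η := by
  have hp0 : p ≠ 0 := (zero_lt_one.trans hp1).ne'
  have hq : 1 < p.toReal := by
    rw [← ENNReal.toReal_one]
    exact (ENNReal.toReal_lt_toReal ENNReal.one_ne_top hp).2 hp1
  have hlim : Tendsto (fun R : ℝ => ENNReal.ofReal (R ^ (1 - p.toReal)) * M ^ p.toReal) atTop
      (𝓝 0) := by
    have h1 : Tendsto (fun R : ℝ => R ^ (-(p.toReal - 1))) atTop (𝓝 0) :=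
      tendsto_rpow_neg_atTop (by linarith)
    have h2 := ENNReal.Tendsto.mul_const (b := M ^ p.toReal) (ENNReal.tendsto_ofReal h1)
      (Or.inr (ENNReal.rpow_ne_top_of_nonneg (by positivity) hM))
    rw [ENNReal.ofReal_zero, zero_mul] at h2
    simpa only [neg_sub] using h2
  obtain ⟨R, hRη, hR⟩ :=
    ((hlim.eventually (gt_mem_nhds (pos_iff_ne_zero.2 hη))).and (eventually_gt_atTop 0)).exists
  refine ⟨R, hR, fun h hh => ?_⟩
  rw [eLpNorm_one_eq_lintegral_enorm]
  have hle : ∀ w, ‖h w - truncate R (h w)‖ₑ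
      ≤ ENNReal.ofReal (R ^ (1 - p.toReal)) * ‖h w‖ₑ ^ p.toReal := fun w => by
    rw [← ofReal_norm, ← ofReal_norm,
      ENNReal.ofReal_rpow_of_nonneg (norm_nonneg _) (by positivity),
      ← ENNReal.ofReal_mul (by positivity)]
    exact ENNReal.ofReal_le_ofReal (norm_sub_truncate_le hR hq.le _)
  refine (lintegral_mono hle).trans ?_
  rw [lintegral_const_mul' _ _ ENNReal.ofReal_ne_top]
  refine le_trans ?_ hRη.le
  gcongr
  rw [eLpNorm_eq_lintegral_rpow_enorm_toReal hp0 hp] at hh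
  have h2 := ENNReal.rpow_le_rpow hh (zero_le_one.trans hq.le)
  rwa [← ENNReal.rpow_mul, one_div_mul_cancel (zero_lt_one.trans hq).ne', ENNReal.rpow_one] at h2

theorem norm_integral_mul_sub_le {u v q : Ω → ℂ} (hu : Integrable u μ) (hv : Integrable v μ)
    (hq : AEStronglyMeasurable q μ) (hq1 : ∀ w, ‖q w‖ ≤ 1) :
    ‖∫ w, u w * q w ∂μ - ∫ w, v w * q w ∂μ‖
      ≤ (eLpNorm (fun w => u w - v w) 1 μ).toReal := by
  have hi : ∀ {u : Ω → ℂ}, Integrable u μ → Integrable (fun w => u w * q w) μ := fun hu =>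
    hu.mul_bdd (c := 1) hq (Filter.Eventually.of_forall hq1)
  rw [← integral_sub (hi hu) (hi hv), eLpNorm_one_eq_lintegral_enorm,
    ← integral_norm_eq_lintegral_enorm (f := fun w => u w - v w) (hu.sub hv).1]
  refine norm_integral_le_of_norm_le (hu.sub hv).norm (Filter.Eventually.of_forall fun w => ?_)
  rw [← sub_mul, norm_mul]
  exact mul_le_of_le_one_right (norm_nonneg _) (hq1 w)

open Filter Topology in
/-- For `1 < p < ∞`, a bounded sequence in `L_p` converges weakly along any ultrafilter. -/
theorem exists_weak_limit_of_eLpNorm_le [IsProbabilityMeasure μ] {p M : ℝ≥0∞} (hp1 : 1 < p)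
    (hp : p ≠ ∞) (hM : M ≠ ∞) (𝒰 : Ultrafilter ℕ) {h : ℕ → Ω → ℂ} (hm : ∀ k, Measurable (h k))
    (hb : ∀ k, eLpNorm (h k) p μ ≤ M) :
    ∃ f, MemLp f p μ ∧ ∀ q : Ω → ℂ, AEStronglyMeasurable q μ → (∀ w, ‖q w‖ ≤ 1) →
      Tendsto (fun k => ∫ w, h k w * q w ∂μ) 𝒰 (𝓝 (∫ w, f w * q w ∂μ)) := by
  -- The shift by `2` makes the sum of two such errors with indices at least `N` strictly smaller
  -- than `(1 / 2) ^ N`, as the completeness argument below needs.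
  have hη : ∀ n : ℕ, ENNReal.ofReal ((1 / 2) ^ (n + 2)) ≠ 0 := fun n =>
    (ENNReal.ofReal_pos.2 (by positivity)).ne'
  choose R hR0 hR using fun n => exists_truncate_radius (μ := μ) hp1 hp hM (hη n)
  have hTm : ∀ k n, Measurable fun w => truncate (R n) (h k w) := fun k n =>
    (measurable_truncate _).comp (hm k)
  have hTb : ∀ k n w, ‖truncate (R n) (h k w)‖ ≤ R n := fun k n w =>
    norm_truncate_le_radius (hR0 n).le _
  have hTmem : ∀ k n, MemLp (fun w => truncate (R n) (h k w)) 2 μ := fun k n =>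
    MemLp.of_bound (hTm k n).aestronglyMeasurable (R n) (Eventually.of_forall (hTb k n))
  let T : ℕ → ℕ → Lp ℂ 2 μ := fun n k => (hTmem k n).toLp _
  have hTae : ∀ n k, T n k =ᵐ[μ] fun w => truncate (R n) (h k w) := fun n k => MemLp.coeFn_toLp _
  have hTn : ∀ n k, ‖T n k‖ ≤ R n := fun n k => by
    have := Lp.norm_le_of_ae_bound (f := T n k) (hR0 n).le
      ((hTae n k).mono fun w hw => by rw [hw]; exact hTb k n w)
    simpa [measureUnivNNReal] using this
  choose F hF using fun n => exists_weak_limit 𝒰 (hTn n)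
  have hFp : ∀ n, eLpNorm (F n) p μ ≤ M := fun n =>
    mem_of_weak_limit (hF n) (convex_setOf_eLpNorm_le hp1.le M) (isClosed_setOf_eLpNorm_le p M)
      fun k => by
        change eLpNorm (T n k) p μ ≤ M
        rw [eLpNorm_congr_ae (hTae n k)]
        exact (eLpNorm_mono fun w => norm_truncate_le _ _).trans (hb k)
  -- For every `k` the truncations at levels `n` and `m` are this close in `L_1`, both being close
  -- to `h k`; the bound passes to the weak limits. So the `F n` are Cauchy in `L_1`, and `f` is
  -- their limit.
  have hFsub : ∀ n m, eLpNorm (fun w => F n w - F m w) 1 μ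
      ≤ ENNReal.ofReal ((1 / 2) ^ (n + 2)) + ENNReal.ofReal ((1 / 2) ^ (m + 2)) := fun n m => by
    change eLpNorm (⇑(F n) - ⇑(F m)) 1 μ ≤ _
    rw [← eLpNorm_congr_ae (Lp.coeFn_sub (F n) (F m))]
    refine mem_of_weak_limit (l := 𝒰) (x := fun k => T n k - T m k) (fun e => ?_)
      (convex_setOf_eLpNorm_le le_rfl _) (isClosed_setOf_eLpNorm_le 1 _) fun k => ?_
    · simp only [inner_sub_right]
      exact (hF n e).sub (hF m e)
    · change eLpNorm (T n k - T m k : Lp ℂ 2 μ) 1 μ ≤ _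
      have hae : (T n k - T m k : Lp ℂ 2 μ) =ᵐ[μ] (fun w => h k w - truncate (R m) (h k w)) -
          fun w => h k w - truncate (R n) (h k w) := by
        filter_upwards [Lp.coeFn_sub (T n k) (T m k), hTae n k, hTae m k] with w h1 h2 h3
        rw [h1, Pi.sub_apply, Pi.sub_apply, h2, h3]
        ring
      rw [eLpNorm_congr_ae hae, add_comm]
      exact (eLpNorm_sub_le ((hm k).sub (hTm k m)).aestronglyMeasurable
        ((hm k).sub (hTm k n)).aestronglyMeasurable le_rfl).trans
        (add_le_add (hR m _ (hb k)) (hR n _ (hb k)))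
  have hF1 : ∀ n, MemLp (F n) 1 μ := fun n => (Lp.memLp (F n)).mono_exponent one_le_two
  obtain ⟨f, hf1, hlim⟩ := Lp.cauchy_complete_eLpNorm (f := fun n => F n) le_rfl hF1
    (B := fun n => ENNReal.ofReal ((1 / 2) ^ n))
    (summable_geometric_of_lt_one (by norm_num) (by norm_num)).tsum_ofReal_ne_top
    fun N n m hn hm => by
      refine (hFsub n m).trans_lt ?_
      have hle : ∀ {n}, N ≤ n → ((1 : ℝ) / 2) ^ (n + 2) ≤ (1 / 2) ^ (N + 2) := fun hn =>
        pow_le_pow_of_le_one (by norm_num) (by norm_num) (by omega)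
      rw [← ENNReal.ofReal_add (by positivity) (by positivity),
        ENNReal.ofReal_lt_ofReal_iff (by positivity)]
      refine (add_le_add (hle hn) (hle hm)).trans_lt ?_
      have : (0 : ℝ) < (1 / 2) ^ N := by positivity
      rw [pow_add]
      nlinarith
  have hfp : MemLp f p μ := ⟨hf1.1, (eLpNorm_le_of_tendsto_eLpNorm one_ne_zero
    (fun n => (hF1 n).1) hf1.1 hlim hFp).trans_lt hM.lt_top⟩
  refine ⟨f, hfp, fun q hq hq1 => ?_⟩
  have hhi : ∀ k, Integrable (h k) μ := fun k =>
    MemLp.integrable hp1.le ⟨(hm k).aestronglyMeasurable, (hb k).trans_lt hM.lt_top⟩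
  have hTi : ∀ k n, Integrable (fun w => truncate (R n) (h k w)) μ := fun k n =>
    (hTmem k n).integrable one_le_two
  have hqmem : MemLp (fun w => starRingEnd ℂ (q w)) 2 μ :=
    MemLp.of_bound (Complex.continuous_conj.comp_aestronglyMeasurable hq) 1
      (Eventually.of_forall fun w => by simpa using hq1 w)
  have hinner : ∀ G : Lp ℂ 2 μ, inner ℂ (hqmem.toLp _) G = ∫ w, G w * q w ∂μ := fun G => by
    rw [L2.inner_def]
    refine integral_congr_ae (hqmem.coeFn_toLp.mono fun w hw => ?_)
    simp only [hw, RCLike.inner_apply, Complex.conj_conj]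
  have hmid : ∀ n, Tendsto (fun k => ∫ w, truncate (R n) (h k w) * q w ∂μ) 𝒰
      (𝓝 (∫ w, F n w * q w ∂μ)) := fun n => by
    have := hF n (hqmem.toLp _)
    simp only [hinner] at this
    refine this.congr fun k => integral_congr_ae ((hTae n k).mono fun w hw => ?_)
    simp only [hw]
  rw [Metric.tendsto_nhds]
  intro ε hε
  have hδ := (ENNReal.tendsto_toReal ENNReal.zero_ne_top).comp hlim
  have hη0 : Tendsto (fun n : ℕ => ((1 : ℝ) / 2) ^ (n + 2)) atTop (𝓝 0) :=
    (tendsto_pow_atTop_nhds_zero_of_lt_one (by norm_num) (by norm_num)).comp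
      (tendsto_add_atTop_nat 2)
  -- The level `n` is fixed before `k`: the truncation error is uniform in `k` and `F n` is near
  -- `f`, so only the middle term depends on the ultrafilter.
  obtain ⟨n, hn1, hn2⟩ := ((hδ.eventually (gt_mem_nhds (show (0 : ℝ≥0∞).toReal < ε / 3 by
    simpa using hε))).and (hη0.eventually (gt_mem_nhds (show 0 < ε / 3 by positivity)))).exists
  filter_upwards [Metric.tendsto_nhds.1 (hmid n) (ε / 3) (by positivity)] with k hk
  rw [dist_eq_norm] at hk ⊢
  have h1 := norm_integral_mul_sub_le (hhi k) (hTi k n) hq hq1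
  have h2 := ENNReal.toReal_le_of_le_ofReal (by positivity) (hR n _ (hb k))
  have h3 := norm_integral_mul_sub_le ((hF1 n).integrable le_rfl) (hf1.integrable le_rfl) hq hq1
  have hn1' : (eLpNorm (fun w => F n w - f w) 1 μ).toReal < ε / 3 := hn1
  calc _ = ‖(∫ w, h k w * q w ∂μ - ∫ w, truncate (R n) (h k w) * q w ∂μ) +
        (∫ w, truncate (R n) (h k w) * q w ∂μ - ∫ w, F n w * q w ∂μ) +
        (∫ w, F n w * q w ∂μ - ∫ w, f w * q w ∂μ)‖ := by congr 1; ring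
    _ < ε := by
      refine (norm_add₃_le).trans_lt ?_
      linarith

end Weak

/-! ### Fourier coefficients of holomorphic functions on tori of varying radii -/

theorem integral_translate_fourier {u : (ℕ → Circle) → ℂ} (v : ℕ → Circle) (α : ℕ →₀ ℤ) :
    ∫ w, u (w * v) * (torusMonomial (-α) w : ℂ) ∂torusMeasure
      = (torusMonomial α v : ℂ) * fourierCoeff u α := by
  have h : ∀ w, u (w * v) * (torusMonomial (-α) w : ℂ)
      = (torusMonomial α v : ℂ) * (u (w * v) * (torusMonomial (-α) (w * v) : ℂ)) := fun w => by
    have h2 : torusMonomial (-α) w = torusMonomial α v * torusMonomial (-α) (w * v) := by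
      rw [torusMonomial_mul, torusMonomial_neg α v]
      rw [mul_comm (torusMonomial (-α) w), mul_inv_cancel_left]
    rw [h2, Circle.coe_mul]
    ring
  simp only [h]
  rw [integral_const_mul, fourierCoeff,
    integral_mul_right_eq_self (fun w => u w * (torusMonomial (-α) w : ℂ)) v]

/-- A translation multiplies the coefficient by a character, and the Poisson average of `t ^ β i` is
its value at `ρ`. This tracks the effect of shrinking a radius without any power series for the
function. -/
theorem fourierCoeff_average {u : (ℕ → Circle) → ℂ} (hu : Continuous u) (i : ℕ)
    (ρ : Set.Ico (0 : ℝ) 1) (β : ℕ →₀ ℕ) :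
    fourierCoeff (fun w => ∫ v, u (w * Pi.mulSingle i (circleBlaschke ρ v)) ∂circleMeasure)
      (natIndex β) = ((ρ : ℝ) : ℂ) ^ β i * fourierCoeff u (natIndex β) := by
  have hB := continuous_circleBlaschke ρ
  have hmono := continuous_torusMonomial (-natIndex β)
  have hsingle : Continuous fun v : Circle => (Pi.mulSingle i v : ℕ → Circle) :=
    continuous_mulSingle (A := fun _ : ℕ => Circle) i
  have hint : Integrable (Function.uncurry fun (w : ℕ → Circle) (v : Circle) =>
      u (w * Pi.mulSingle i (circleBlaschke ρ v)) * (torusMonomial (-natIndex β) w : ℂ))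
      (torusMeasure.prod circleMeasure) := by
    have hc : Continuous fun q : (ℕ → Circle) × Circle =>
        u (q.1 * Pi.mulSingle i (circleBlaschke ρ q.2)) *
          (torusMonomial (-natIndex β) q.1 : ℂ) := by
      have h2 : Continuous fun q : (ℕ → Circle) × Circle =>
        (Pi.mulSingle i (circleBlaschke ρ q.2) : ℕ → Circle) :=
        hsingle.comp (hB.comp continuous_snd)
      exact (hu.comp (continuous_fst.mul h2)).mul (hmono.comp continuous_fst)
    obtain ⟨C, hC⟩ := isCompact_univ.exists_bound_of_continuousOn hc.continuousOn
    exact Integrable.of_bound hc.aestronglyMeasurable C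
      (Filter.Eventually.of_forall fun w => hC w (Set.mem_univ w))
  have h1 : ∀ v : Circle, ((torusMonomial (natIndex β) (Pi.mulSingle i (circleBlaschke ρ v)) :
      Circle) : ℂ) = (circleBlaschke ρ v : ℂ) ^ β i := fun v => by
    rw [torusMonomial_mulSingle, natIndex_apply, zpow_natCast]
    rfl
  simp only [fourierCoeff, ← integral_mul_const]
  rw [integral_integral_swap hint]
  simp only [integral_translate_fourier, h1]
  rw [integral_mul_const, integral_circleBlaschke (F := fun t => t ^ β i) (by fun_prop)]
  rfl

/-- Averaging over the coordinate `i` leaves the mean of a holomorphic function of `v` times `v ^ k`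
with `k = -α i > 0`, which vanishes by the mean value property. -/
theorem fourierCoeff_eq_zero_of_neg {H : (ℕ → ℂ) → ℂ} {x : ℕ → ℝ}
    (hc : Continuous fun w => H (scaledPoint x w)) {i : ℕ}
    (hH : ∀ w, DifferentiableOn ℂ (fun t => H fun j => scaledPoint x w j *
      (Function.update 1 i t : ℕ → ℂ) j) (Metric.closedBall 0 1)) {α : ℕ →₀ ℤ} (hα : α i < 0) :
    fourierCoeff (fun w => H (scaledPoint x w)) α = 0 := by
  have hmono := continuous_torusMonomial (-α)
  obtain ⟨k, hk, hk0⟩ : ∃ k : ℕ, (-α) i = k ∧ k ≠ 0 :=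
    ⟨((-α) i).toNat, by simp; omega, by simp; omega⟩
  rw [fourierCoeff, ← integral_integral_mul (ν := circleMeasure)
    (u := fun w => H (scaledPoint x w) * (torusMonomial (-α) w : ℂ))
    (integrable_of_continuous (hc.mul hmono)) (measurable_mulSingle i)]
  refine integral_eq_zero_of_ae (Filter.Eventually.of_forall fun w => ?_)
  have h1 : ∀ v : Circle, H (scaledPoint x (w * Pi.mulSingle i v)) *
      (torusMonomial (-α) (w * Pi.mulSingle i v) : ℂ) = (torusMonomial (-α) w : ℂ) *
        ((H fun j => scaledPoint x w j * (Function.update 1 i (v : ℂ) : ℕ → ℂ) j) *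
          (v : ℂ) ^ k) := fun v => by
    rw [scaledPoint_mul_mulSingle, torusMonomial_mul, torusMonomial_mulSingle, hk, zpow_natCast,
      Circle.coe_mul, Circle.coe_pow]
    ring
  simp only [h1, Pi.zero_apply]
  rw [integral_const_mul, integral_circle_eq (F := fun t => (H fun j => scaledPoint x w j *
    (Function.update 1 i t : ℕ → ℂ) j) * t ^ k)]
  · simp [hk0]
  · refine DifferentiableOn.diffContOnCl ?_
    rw [closure_ball _ one_ne_zero]
    exact (hH w).mul (by fun_prop)

/-- A function on `ℓ₂` evaluated at a truncated sequence. -/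
def truncEval (G : ellTwo → ℂ) (N : ℕ) (y : ℕ → ℂ) : ℂ := G (finPoint fun i : Fin N => y i)

theorem differentiable_finPoint (n : ℕ) : Differentiable ℂ fun a : Fin n → ℂ => finPoint a := by
  unfold finPoint
  refine Differentiable.fun_sum fun i _ => ?_
  exact (lp.singleContinuousLinearMap ℂ (fun _ : ℕ => ℂ) 2 (i : ℕ)).differentiable.comp
    (differentiable_apply i)

theorem norm_scaledPoint_lt {x : ℕ → ℝ} (hx : ∀ i, x i ∈ Set.Ico (0 : ℝ) 1) (w : ℕ → Circle)
    (i : ℕ) : ‖scaledPoint x w i‖ < 1 := by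
  rw [scaledPoint, norm_mul, torusCoe, Circle.norm_coe, mul_one, Complex.norm_real,
    Real.norm_of_nonneg (hx i).1]
  exact (hx i).2

theorem differentiableOn_truncEval {G : ellTwo → ℂ} (hG : DifferentiableOn ℂ G polydisc)
    (N : ℕ) {y : ℕ → ℂ} (hy : ∀ j, ‖y j‖ < 1) (i : ℕ) :
    DifferentiableOn ℂ (fun t => truncEval G N fun j => y j * (Function.update 1 i t : ℕ → ℂ) j)
      (Metric.closedBall 0 1) := by
  refine hG.comp (f := fun t => finPoint fun j : Fin N => y j *
    (Function.update 1 i t : ℕ → ℂ) j) (Differentiable.differentiableOn ?_) fun t ht => ?_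
  · refine (differentiable_finPoint N).comp (differentiable_pi.2 fun j => ?_)
    by_cases hj : (j : ℕ) = i
    · simpa [hj] using differentiable_id.const_mul (y i)
    · simp [hj]
  · refine finPoint_mem fun j => ?_
    rw [norm_mul]
    refine lt_of_le_of_lt (mul_le_of_le_one_right (norm_nonneg _) ?_) (hy j)
    by_cases hj : (j : ℕ) = i
    · simpa [hj] using ht
    · simp [hj]

theorem continuous_truncEval {G : ellTwo → ℂ} (hG : DifferentiableOn ℂ G polydisc)
    (N : ℕ) {x : ℕ → ℝ} (hx : ∀ i, x i ∈ Set.Ico (0 : ℝ) 1) :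
    Continuous fun w => truncEval G N (scaledPoint x w) := by
  have h := continuous_scaledPoint x
  refine hG.continuousOn.comp_continuous (f := fun w => finPoint fun i : Fin N =>
    scaledPoint x w i) (continuous_finPoint.comp (by fun_prop)) fun w => ?_
  exact finPoint_mem fun i => norm_scaledPoint_lt hx w i

theorem fourierCoeff_truncEval {G : ellTwo → ℂ} (hG : DifferentiableOn ℂ G polydisc)
    (N : ℕ) {x : ℕ → ℝ} (hx : ∀ i, x i ∈ Set.Ico (0 : ℝ) 1)
    {ρ : ℕ → ℝ} (hρ : ∀ i, ρ i ∈ Set.Ico (0 : ℝ) 1) (β : ℕ →₀ ℕ) (S : Finset ℕ) :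
    fourierCoeff (fun w => truncEval G N
      (scaledPoint (fun i => if i ∈ S then ρ i * x i else x i) w)) (natIndex β)
      = (∏ i ∈ S, (ρ i : ℂ) ^ β i) *
        fourierCoeff (fun w => truncEval G N (scaledPoint x w)) (natIndex β) := by
  induction S using Finset.induction_on with
  | empty => simp
  | insert i S hi ih =>
    set y : ℕ → ℝ := fun j => if j ∈ S then ρ j * x j else x j with hy
    have hyi : (fun j => if j ∈ insert i S then ρ j * x j else x j)
        = Function.update y i (ρ i * y i) := by
      funext j
      by_cases hj : j = i
      · subst hj; simp [hy, hi]
      · simp [hy, hj]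
    have hym : ∀ j, y j ∈ Set.Ico (0 : ℝ) 1 := fun j => by
      simp only [hy]
      split_ifs
      · exact ⟨mul_nonneg (hρ j).1 (hx j).1,
          mul_lt_one_of_nonneg_of_lt_one_left (hρ j).1 (hρ j).2 (hx j).2.le⟩
      · exact hx j
    rw [Finset.prod_insert hi, mul_assoc, ← ih, hyi,
      ← fourierCoeff_average (continuous_truncEval hG N hym) i ⟨ρ i, hρ i⟩ β]
    congr 1
    funext w
    exact (integral_scaledPoint_mulSingle (ρ := ⟨ρ i, hρ i⟩)
      (differentiableOn_truncEval hG N (norm_scaledPoint_lt hym w) i)).symm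

theorem truncEval_radii {G : ellTwo → ℂ} {g : polydisc → ℂ} (hGg : ∀ z : polydisc, G z = g z) {n N : ℕ}
    (hn : n ≤ N) (r : Set.Ioo (0 : ℝ) 1) (w : ℕ → Circle) :
    truncEval G N (scaledPoint (radii n r) w) = g (torusPoint r (torusRestrict n w)) := by
  rw [← hGg, truncEval]
  congr 1
  ext i
  rw [torusPoint_torusRestrict_apply, finPoint_apply]
  split_ifs with h
  · rfl
  · have : ¬ i < n := by omega
    simp [scaledPoint, radii, this]

theorem fourierCoeff_torusPoint_neg {G : ellTwo → ℂ} (hG : DifferentiableOn ℂ G polydisc)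
    {g : polydisc → ℂ} (hGg : ∀ z : polydisc, G z = g z) (n : ℕ)
    (r : Set.Ioo (0 : ℝ) 1) {α : ℕ →₀ ℤ} (hα : ∃ i, α i < 0) :
    fourierCoeff (fun w => g (torusPoint r (torusRestrict n w))) α = 0 := by
  obtain ⟨i, hi⟩ := hα
  simp only [← truncEval_radii hGg le_rfl]
  exact fourierCoeff_eq_zero_of_neg (continuous_truncEval hG n (radii_mem n r))
    (fun w => differentiableOn_truncEval hG n (norm_scaledPoint_lt (radii_mem n r) w) i) hi

/-- Going from `N` variables at radius `r'` to `n` variables at radius `r` is a shrinking by the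
factors `radii n s`. The factor `0` at the coordinates from `n` on deletes those variables; with `0
^ 0 = 1`, indices supported below `n` are unaffected and the others get coefficient zero. -/
theorem fourierCoeff_torusPoint {G : ellTwo → ℂ} (hG : DifferentiableOn ℂ G polydisc)
    {g : polydisc → ℂ} (hGg : ∀ z : polydisc, G z = g z) {n N : ℕ}
    (hn : n ≤ N) (r r' s : Set.Ioo (0 : ℝ) 1) (hr : (r : ℝ) = s * r') {β : ℕ →₀ ℕ}
    (hβ : β.support ⊆ Finset.range N) :
    fourierCoeff (fun w => g (torusPoint r (torusRestrict n w))) (natIndex β)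
      = seqMonomial β (fun i => (radii n s i : ℂ)) *
        fourierCoeff (fun w => g (torusPoint r' (torusRestrict N w))) (natIndex β) := by
  simp only [← truncEval_radii hGg hn, ← truncEval_radii hGg (le_refl N)]
  rw [seqMonomial_eq_prod hβ,
    ← fourierCoeff_truncEval hG N (radii_mem N r') (radii_mem n s) β (Finset.range N)]
  congr 1
  funext w
  congr 1
  funext i
  simp only [scaledPoint, radii, Finset.mem_range, hr]
  split_ifs <;> first | omega | simp

theorem seqMonomial_scaledPoint (α : ℕ →₀ ℕ) (x : ℕ → ℝ) (w : ℕ → Circle) :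
    seqMonomial α (scaledPoint x w)
      = seqMonomial α (fun i => (x i : ℂ)) * (torusMonomial (natIndex α) w : ℂ) := by
  rw [← seqMonomial_torusCoe, ← seqMonomial_mul]
  rfl

/-! ### Surjectivity for `1 < p` -/

section

variable {p : ℝ≥0∞} [hp1 : Fact (1 ≤ p)]

/-- The series converges absolutely and uniformly on the torus, because the moduli of its terms do
not depend on `w`; it can be integrated term by term. -/
theorem fourierCoeff_hpExtension (hp : p ≠ ∞) (f : HpTorus p) (n : ℕ) (r : Set.Ioo (0 : ℝ) 1)
    (β : ℕ →₀ ℕ) :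
    fourierCoeff (fun w => hpExtension f (torusPoint r (torusRestrict n w))) (natIndex β)
      = seqMonomial β (fun i => (radii n r i : ℂ)) * hpCoeff p β f := by
  set a : (ℕ →₀ ℕ) → ℂ := fun α => hpCoeff p α f * seqMonomial α (fun i => (radii n r i : ℂ))
    with ha
  have hsum : Summable fun α => ‖a α‖ := by
    have h := (summable_hpEval hp f (torusPoint r (torusRestrict n 1)).2).norm
    refine h.congr fun α => ?_
    simp only [torusPoint_torusRestrict_apply]
    congr 3
    funext i
    simp [scaledPoint, torusCoe]
  let F : (ℕ →₀ ℕ) → (ℕ → Circle) → ℂ := fun α w =>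
    a α * ((torusMonomial (natIndex α) w : ℂ) * (torusMonomial (-natIndex β) w : ℂ))
  have hmono := continuous_torusMonomial
  have hF : ∀ α, Integrable (F α) torusMeasure := fun α =>
    integrable_of_continuous (by fun_prop)
  have hFn : ∀ α, ∫ w, ‖F α w‖ ∂torusMeasure = ‖a α‖ := fun α => by
    simp [F, Circle.norm_coe]
  have hFi : ∀ α, ∫ w, F α w ∂torusMeasure = if α = β then a α else 0 := fun α => by
    have := fourierCoeff_torusMonomial (natIndex α) (natIndex β)
    rw [fourierCoeff] at this
    simp only [F]
    rw [integral_const_mul, this]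
    simp [natIndex_injective.eq_iff]
  have h := hasSum_integral_of_summable_integral_norm hF (by simpa only [hFn] using hsum)
  simp only [hFi] at h
  have h2 := h.unique (hasSum_single β fun α hα => if_neg hα)
  rw [if_pos rfl] at h2
  rw [mul_comm]
  refine Eq.trans (integral_congr_ae (Filter.Eventually.of_forall fun w => ?_)) h2
  simp only [F, hpExtension, hpEval, torusPoint_torusRestrict_apply, seqMonomial_scaledPoint]
  rw [← tsum_mul_right]
  refine tsum_congr fun α => ?_
  simp only [ha]
  ring

theorem surjective_hpExtensionLI (hp : p ≠ ∞) (hp2 : 1 < p) :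
    Function.Surjective (hpExtensionLI p hp) := by
  intro g
  obtain ⟨G, hG, hGg⟩ := g.2.1
  have hgc : ∀ (n : ℕ) (r : Set.Ioo (0 : ℝ) 1),
      Continuous fun w => g (torusPoint r (torusRestrict n w)) := fun n r =>
    g.2.1.continuous.comp ((continuous_torusPoint r).comp (continuous_torusRestrict n))
  have hmono := continuous_torusMonomial
  obtain ⟨f, hf, hlim⟩ := exists_weak_limit_of_eLpNorm_le (μ := torusMeasure) hp2 hp
    g.2.2.ne (Filter.hyperfilter ℕ)
    (h := fun k w => g (torusPoint (radiusSeq k) (torusRestrict k w)))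
    (fun k => (hgc k _).measurable) fun k => by
      rw [← eLpNorm_torusPoint g.2.1]
      exact eLpNorm_le_hpNorm p _ k (radiusSeq k)
  have hcoeff : ∀ α, Filter.Tendsto (fun k => fourierCoeff
      (fun w => g (torusPoint (radiusSeq k) (torusRestrict k w))) α) (Filter.hyperfilter ℕ)
      (nhds (fourierCoeff f α)) := fun α =>
    hlim _ (hmono (-α)).aestronglyMeasurable fun w => (Circle.norm_coe _).le
  have hfneg : ∀ α : ℕ →₀ ℤ, (∃ i, α i < 0) → fourierCoeff f α = 0 := fun α hα => by
    have h := hcoeff α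
    simp only [fourierCoeff_torusPoint_neg hG hGg _ _ hα] at h
    exact tendsto_nhds_unique h tendsto_const_nhds
  let F : HpTorus p := ⟨hf.toLp f, fun α hα => by
    rw [fourierCoeff_congr hf.coeFn_toLp]; exact hfneg α hα⟩
  have hF : ∀ β, hpCoeff p β F = fourierCoeff f (natIndex β) := fun β =>
    fourierCoeff_congr hf.coeFn_toLp _
  have hgcoeff : ∀ (n : ℕ) (r : Set.Ioo (0 : ℝ) 1) (β : ℕ →₀ ℕ),
      fourierCoeff (fun w => g (torusPoint r (torusRestrict n w))) (natIndex β)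
        = seqMonomial β (fun i => (radii n r i : ℂ)) * hpCoeff p β F := fun n r β => by
    -- The coefficient on the fixed torus equals that on the `k`-th torus times a monomial in `r /
    -- radiusSeq k`, as soon as `r < radiusSeq k` and `k` exceeds both `n` and the support of `β`.
    -- The product is constant in `k`, so its limit along the ultrafilter is its value.
    have h1 : Filter.Tendsto (fun k => seqMonomial β
        (fun i => (radii n ((r : ℝ) / radiusSeq k) i : ℂ))) Filter.atTop
        (nhds (seqMonomial β (fun i => (radii n r i : ℂ)))) := by
      refine ((continuous_seqMonomial β).tendsto _).comp (tendsto_pi_nhds.2 fun i => ?_)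
      refine (Complex.continuous_ofReal.tendsto _).comp ?_
      unfold radii
      split_ifs
      · have h := (tendsto_const_nhds (x := (r : ℝ))).div tendsto_radiusSeq one_ne_zero
        rw [div_one] at h
        exact h
      · exact tendsto_const_nhds
    have h2 := (h1.mono_left Nat.hyperfilter_le_atTop).mul (hcoeff (natIndex β))
    rw [hF]
    refine tendsto_nhds_unique (tendsto_const_nhds.congr' ?_) h2
    obtain ⟨m, hm⟩ := β.support.exists_nat_subset_range
    refine Filter.Eventually.filter_mono Nat.hyperfilter_le_atTop ?_
    filter_upwards [tendsto_radiusSeq.eventually (lt_mem_nhds r.2.2),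
      Filter.eventually_ge_atTop n, Filter.eventually_ge_atTop m] with k hk hkn hkm
    have hpos : (0 : ℝ) < radiusSeq k := (radiusSeq k).2.1
    exact fourierCoeff_torusPoint hG hGg hkn r (radiusSeq k)
      ⟨(r : ℝ) / radiusSeq k, div_pos r.2.1 hpos, (div_lt_one hpos).2 hk⟩
      (div_mul_cancel₀ _ hpos.ne').symm
      (hm.trans (Finset.range_subset_range.2 hkm))
  refine ⟨F, Subtype.ext ?_⟩
  have hFhol := isHolomorphic_hpExtension hp F
  have hholo : IsHolomorphic (hpExtension F - g.1) := by
    have := hFhol.add (g.2.1.smul (-1))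
    rwa [neg_one_smul, ← sub_eq_add_neg] at this
  have hzero : hpNorm p (hpExtension F - g.1) = 0 := by
    refine le_antisymm (iSup₂_le fun n r => ?_) bot_le
    rw [eLpNorm_torusPoint hholo]
    have hFc : Continuous fun w => hpExtension F (torusPoint r (torusRestrict n w)) :=
      hFhol.continuous.comp ((continuous_torusPoint r).comp (continuous_torusRestrict n))
    -- On each torus both functions are continuous with the same Fourier coefficients, so they agree
    -- there; the difference then has norm zero and vanishes on the whole domain.
    have hu := eq_zero_of_fourierCoeff_eq_zero (hFc.sub (hgc n r)) fun α => by
      have hsub : fourierCoeff (fun w => hpExtension F (torusPoint r (torusRestrict n w))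
          - g (torusPoint r (torusRestrict n w))) α
          = fourierCoeff (fun w => hpExtension F (torusPoint r (torusRestrict n w))) α
            - fourierCoeff (fun w => g (torusPoint r (torusRestrict n w))) α := by
        simp only [fourierCoeff, sub_mul]
        exact integral_sub (integrable_of_continuous (hFc.mul (hmono (-α))))
          (integrable_of_continuous ((hgc n r).mul (hmono (-α))))
      refine hsub.trans ?_
      by_cases hα : ∃ i, α i < 0
      · rw [fourierCoeff_torusPoint_neg hG hGg n r hα,
          fourierCoeff_torusPoint_neg (g := hpExtension F)
            (differentiableOn_hpEval hp F) (fun _ => rfl) n r hα, sub_zero]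
      · simp only [not_exists, not_lt] at hα
        obtain ⟨β, rfl⟩ := exists_natIndex_eq hα
        rw [hgcoeff, fourierCoeff_hpExtension hp, sub_self]
    have hu' : (fun w => (hpExtension F - g.1) (torusPoint r (torusRestrict n w))) = 0 := hu
    rw [hu', eLpNorm_zero]
  exact sub_eq_zero.1 (eq_zero_of_hpNorm_eq_zero hholo hzero)

end

end HardyInf

end

theorem theorem5p1 (p : ℝ≥0∞) [Fact (1 ≤ p)] (hp : p ≠ ∞) :
    ∃ φ : HardyInf.HpTorus p →ₗᵢ[ℂ] HardyInf.HpDisc p,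
      (∀ (f : HardyInf.HpTorus p) (z : HardyInf.polydisc),
        HasSum (fun α : ℕ →₀ ℕ =>
          HardyInf.fourierCoeff (f : Lp ℂ p HardyInf.torusMeasure) (HardyInf.natIndex α) *
            HardyInf.discMonomial α z) (φ f z)) ∧
      (1 < p → Function.Surjective φ) ∧
      (p = 1 → Set.range φ =
        closure (Submodule.span ℂ (Set.range (HardyInf.hpMonomial p)) :
          Set (HardyInf.HpDisc p))) :=
  ⟨HardyInf.hpExtensionLI p hp, fun f z => (HardyInf.summable_hpEval hp f z.2).hasSum,
    HardyInf.surjective_hpExtensionLI hp, fun _ => HardyInf.range_hpExtensionLI hp⟩
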